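/- **Setting.** Let $M$ be a smooth $n$-dimensional manifold and $F:TM\to[0,\infty)$ a Finsler structure: $F$ is smooth on $TM\setminus 0$, $F(x,\lambda y)=\lambda F(x,y)$ for $\lambda>0$, and $g_{ij}(x,y)=\frac12\frac{\partial^2F^2}{\partial y^i\partial y^j}$ is positive definite for $y\ne0$. Let $\nabla^{ch}$ be its Chern connection, with coefficients $\Gamma^i_{jk}(x,y)=\frac12g^{is}\left(\frac{\delta g_{sj}}{\delta x^k}-\frac{\delta g_{jk}}{\delta x^s}+\frac{\delta g_{sk}}{\delta x^j}\right)$ in natural coordinates, where $\frac{\delta}{\delta x^k}=\frac{\partial}{\partial x^k}-N^i_k\frac{\partial}{\partial y^i}$, $N^i_j=\gamma^i_{jk}y^k-\frac1F A^i_{jk}\gamma^k_{rs}y^ry^s$, $\gamma^i_{jk}$ are the formal Christoffel symbols of $g_{ij}$ (derivatives in $x$ only), and $A_{ijk}=\frac F2\frac{\partial g_{ij}}{\partial y^k}$. Let $P_j{}^i{}_{kl}=-F\,\partial\Gamma^i_{jk}/\partial y^l$ be its $hv$-curvature. * $(M,F)$ is *Landsberg* if $P^n_{ikl}:=\ell_jP_i{}^j{}_{kl}=0$,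 where $\ell_j=g_{jm}y^m/F$ (the index $n$ refers to $e_n=y/F$). It is *Berwald* if the $\Gamma^i_{jk}$ do not depend on $y$. It is *locally Minkowski* if around each point there are coordinates of $M$ in whose natural coordinates $F$ depends on $y$ only. It is *pure Landsberg* if it is Landsberg and neither Berwald nor locally Minkowski. * The *averaged Chern connection* $\langle\nabla^{ch}\rangle$ is the affine connection on $M$ with coefficients $\frac1{\mathrm{vol}(I_x)}\int_{I_x}\Gamma^i_{jk}(x,u)\,d\mathrm{vol}(u)$, where $I_x=\{y\in T_xM: F(x,y)=1\}$ is the indicatrix with the volume induced by the Riemannian metric $g_{ij}(x,y)\,dy^idy^j$ on $T_xM\setminus\{0\}$. * An affine connection *leaves invariant* a family of subsets $R_x\subset T_xM$ $(x\in M)$ if its parallel transport along every $C^1$ curve $[0,1]\to M$ from $x$ to $z$ maps $R_x$ onto $R_z$. * For a smooth Riemannian metric $h$ on $M$ and $t\in[0,1]$ put $F_t(x,y)=(1-t)F(x,y)+t\sqrt{h_x(y,y)}$, $I_x(t)=\{y\in T_xM: F_t(x,y)=1\}$ and $R^h_x=\bigcup_{t\in[0,1]}I_x(t)$. **Theorem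 4.2.** Let $(M,F)$ be a Landsberg space. Suppose that $\langle\nabla^{ch}\rangle$ does not leave invariant the family $(R^h_x)_{x\in M}$ for any smooth Riemannian metric $h$ on $M$ such that 1. the Levi-Civita connection of $h$ leaves invariant the indicatrices $(I_x)_{x\in M}$ of $F$, 2. for every $x\in M$ the sets $I_x(t)$, $t\in[0,1]$, are pairwise disjoint, and 3. for every $x\in M$ the set $R^h_x$ is a compact codimension-zero submanifold (possibly with boundary) of $T_xM$. Then $(M,F)$ is a pure Landsberg space; in particular it is not Berwald. -/

import Mathlib

open Bundle Set MeasureTheory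
open scoped Manifold ContDiff ENNReal

noncomputable section

/-! ### Local Finsler geometry in natural coordinates

In this part `f a y` is the coordinate expression of a Finsler function: `a` is the vector of
coordinates of the base point and `y` the vector of components of a tangent vector. -/

namespace FinslerLocal

variable {n : ℕ}

/-- The partial derivative `∂f/∂xⁱ`. -/
def dX (i : Fin n) (f : EuclideanSpace ℝ (Fin n) → EuclideanSpace ℝ (Fin n) → ℝ)
    (a y : EuclideanSpace ℝ (Fin n)) : ℝ :=
  fderiv ℝ (fun b => f b y) a (EuclideanSpace.single i 1)

/-- The partial derivative `∂f/∂yⁱ`. -/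
def dY (i : Fin n) (f : EuclideanSpace ℝ (Fin n) → EuclideanSpace ℝ (Fin n) → ℝ)
    (a y : EuclideanSpace ℝ (Fin n)) : ℝ :=
  fderiv ℝ (fun z => f a z) y (EuclideanSpace.single i 1)

/-- The fundamental tensor `g_{ij} = ½ ∂²(f²)/∂yⁱ∂yʲ`, as a matrix. -/
def fundamental (f : EuclideanSpace ℝ (Fin n) → EuclideanSpace ℝ (Fin n) → ℝ)
    (a y : EuclideanSpace ℝ (Fin n)) : Matrix (Fin n) (Fin n) ℝ :=
  Matrix.of fun i j => 1 / 2 * dY i (dY j fun b z => f b z ^ 2) a y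

/-- The Christoffel expression `½ G^{is} (D_k G_{sj} - D_s G_{jk} + D_j G_{sk})` of a matrix `G`
whose derivatives in the coordinate directions are the matrices `D k`. -/
def christoffel (G : Matrix (Fin n) (Fin n) ℝ) (D : Fin n → Matrix (Fin n) (Fin n) ℝ)
    (i j k : Fin n) : ℝ :=
  1 / 2 * ∑ s, G⁻¹ i s * (D k s j - D s j k + D j s k)

/-- The formal Christoffel symbols `γⁱ_{jk}` of the fundamental tensor. -/
def formalChristoffel (f : EuclideanSpace ℝ (Fin n) → EuclideanSpace ℝ (Fin n) → ℝ)
    (i j k : Fin n) (a y : EuclideanSpace ℝ (Fin n)) : ℝ :=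
  christoffel (fundamental f a y)
    (fun k => Matrix.of fun i j => dX k (fun b z => fundamental f b z i j) a y) i j k

/-- The Cartan tensor `A_{ijk} = (f/2) ∂g_{ij}/∂yᵏ`. -/
def cartan (f : EuclideanSpace ℝ (Fin n) → EuclideanSpace ℝ (Fin n) → ℝ)
    (i j k : Fin n) (a y : EuclideanSpace ℝ (Fin n)) : ℝ :=
  f a y / 2 * dY k (fun b z => fundamental f b z i j) a y

/-- The Cartan tensor with its first index raised, `Aⁱ_{jk} = g^{il} A_{ljk}`. -/
def cartanUp (f : EuclideanSpace ℝ (Fin n) → EuclideanSpace ℝ (Fin n) → ℝ)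
    (i j k : Fin n) (a y : EuclideanSpace ℝ (Fin n)) : ℝ :=
  ∑ l, (fundamental f a y)⁻¹ i l * cartan f l j k a y

/-- The coefficients of the non-linear connection,
`Nⁱ_j = γⁱ_{jk} yᵏ - Aⁱ_{jk} γᵏ_{rs} yʳ yˢ / f`. -/
def nonlinear (f : EuclideanSpace ℝ (Fin n) → EuclideanSpace ℝ (Fin n) → ℝ)
    (i j : Fin n) (a y : EuclideanSpace ℝ (Fin n)) : ℝ :=
  ∑ k, formalChristoffel f i j k a y * y k
    - ∑ k, cartanUp f i j k a y *
        (∑ r, ∑ s, formalChristoffel f k r s a y * y r * y s) / f a y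

/-- The horizontal derivative `δ/δxᵏ = ∂/∂xᵏ - Nⁱ_k ∂/∂yⁱ`, applied to a function `q`. -/
def delta (f : EuclideanSpace ℝ (Fin n) → EuclideanSpace ℝ (Fin n) → ℝ) (k : Fin n)
    (q : EuclideanSpace ℝ (Fin n) → EuclideanSpace ℝ (Fin n) → ℝ)
    (a y : EuclideanSpace ℝ (Fin n)) : ℝ :=
  dX k q a y - ∑ i, nonlinear f i k a y * dY i q a y

/-- The coefficients of the Chern connection,
`Γⁱ_{jk} = ½ g^{is} (δg_{sj}/δxᵏ - δg_{jk}/δxˢ + δg_{sk}/δxʲ)`. With `ωⁱ_j = Γⁱ_{jk} dxᵏ` this is the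
unique solution of the structure equations `dxʲ ∧ ωⁱ_j = 0` and
`dg_{ij} - g_{kj} ωᵏ_i - g_{ik} ωᵏ_j = 2 A_{ijk} δyᵏ/f`. -/
def chern (f : EuclideanSpace ℝ (Fin n) → EuclideanSpace ℝ (Fin n) → ℝ)
    (i j k : Fin n) (a y : EuclideanSpace ℝ (Fin n)) : ℝ :=
  christoffel (fundamental f a y)
    (fun k => Matrix.of fun i j => delta f k (fun b z => fundamental f b z i j) a y) i j k

/-- The `hv`-curvature of the Chern connection, `P_j{}ⁱ{}_{kl} = -f ∂Γⁱ_{jk}/∂yˡ`. -/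
def hvCurvature (f : EuclideanSpace ℝ (Fin n) → EuclideanSpace ℝ (Fin n) → ℝ)
    (j i k l : Fin n) (a y : EuclideanSpace ℝ (Fin n)) : ℝ :=
  -(f a y) * dY l (chern f i j k) a y

/-- The component `Pⁿ_{ikl} = ℓ_j P_i{}ʲ{}_{kl}` of the `hv`-curvature along `e_n = y / f`, where
`ℓ_j = g_{jm} yᵐ / f`. -/
def landsberg (f : EuclideanSpace ℝ (Fin n) → EuclideanSpace ℝ (Fin n) → ℝ)
    (i k l : Fin n) (a y : EuclideanSpace ℝ (Fin n)) : ℝ :=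
  ∑ j, (∑ m, fundamental f a y j m * (y m / f a y)) * hvCurvature f i j k l a y

/-- The Riemannian volume measure `√(det g) dy` of the metric `g_{ij}(a, y) dyⁱ dyʲ` on the
punctured tangent space. -/
def fiberVolume (f : EuclideanSpace ℝ (Fin n) → EuclideanSpace ℝ (Fin n) → ℝ)
    (a : EuclideanSpace ℝ (Fin n)) : Measure (EuclideanSpace ℝ (Fin n)) :=
  volume.withDensity fun y => ENNReal.ofReal (Real.sqrt (fundamental f a y).det)

/-- The Riemannian volume measure that `g_{ij}(a, y) dyⁱ dyʲ` induces on the indicatrix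
`{y | f a y = 1}`. The metric `g(a, ·)` is homogeneous of degree `0`, and along the indicatrix the
radial vector `y` is its unit normal (`g_y(y, y) = f²` and `g_y(y, v) = ½ d(f²)_y(v)`), so `g(a, ·)` is
the cone metric `df² + f² g|_{indicatrix}`. Hence the induced volume `vol` satisfies
`fiberVolume {r u | 0 < r < 1, u ∈ B} = ∫₀¹ rⁿ⁻¹ vol(B) dr = vol(B) / n`,
which is the construction of surface measure in `MeasureTheory.Measure.toSphere`. -/
def indicatrixVolume (f : EuclideanSpace ℝ (Fin n) → EuclideanSpace ℝ (Fin n) → ℝ)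
    (a : EuclideanSpace ℝ (Fin n)) : Measure (EuclideanSpace ℝ (Fin n)) :=
  (n : ℝ≥0∞) • ((fiberVolume f a).restrict {y | f a y < 1}).map fun y => (f a y)⁻¹ • y

/-- The coefficients `(1 / vol(I_a)) ∫_{I_a} Γⁱ_{jk}(a, u) dvol(u)` of the averaged Chern
connection. -/
def averagedChern (f : EuclideanSpace ℝ (Fin n) → EuclideanSpace ℝ (Fin n) → ℝ)
    (i j k : Fin n) (a : EuclideanSpace ℝ (Fin n)) : ℝ :=
  ⨍ u, chern f i j k a u ∂(indicatrixVolume f a)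

end FinslerLocal

/-! ### Finsler structures on manifolds -/

/-- The expression in the natural coordinates of a chart `φ` of a function on the tangent bundle. -/
def inNaturalCoords {n : ℕ} {M : Type*} [TopologicalSpace M]
    [ChartedSpace (EuclideanSpace ℝ (Fin n)) M]
    (F : TangentBundle (𝓡 n) M → ℝ) (φ : OpenPartialHomeomorph M (EuclideanSpace ℝ (Fin n)))
    (a y : EuclideanSpace ℝ (Fin n)) : ℝ :=
  F ⟨φ.symm a, mfderiv (𝓡 n) (𝓡 n) φ.symm a y⟩

/-- A Finsler structure on an `n`-dimensional smooth manifold. -/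
structure FinslerStructure (n : ℕ) (M : Type*) [TopologicalSpace M]
    [ChartedSpace (EuclideanSpace ℝ (Fin n)) M] [IsManifold (𝓡 n) ∞ M] where
  /-- The Finsler function. -/
  toFun : TangentBundle (𝓡 n) M → ℝ
  nonneg : ∀ v, 0 ≤ toFun v
  /-- `F` is smooth on the slit tangent bundle. -/
  smooth : ContMDiffOn (𝓡 n).tangent 𝓘(ℝ, ℝ) ∞ toFun {v | v.2 ≠ 0}
  /-- `F` is positively homogeneous. -/
  homogeneous : ∀ (x : M) (y : TangentSpace (𝓡 n) x) (r : ℝ), 0 < r →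
    toFun ⟨x, r • y⟩ = r * toFun ⟨x, y⟩
  /-- Strong convexity: `g_{ij}` is positive definite on the slit tangent bundle. -/
  convex : ∀ φ ∈ IsManifold.maximalAtlas (𝓡 n) ∞ M, ∀ a ∈ φ.target,
    ∀ y : EuclideanSpace ℝ (Fin n), y ≠ 0 →
      (FinslerLocal.fundamental (inNaturalCoords toFun φ) a y).PosDef

/-! ### Affine connections and parallel transport -/

section Parallel

variable {n : ℕ} {M : Type*} [TopologicalSpace M] [ChartedSpace (EuclideanSpace ℝ (Fin n)) M]
  [IsManifold (𝓡 n) ∞ M]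

/-- Let `Γ φ i j k a` be the coefficients `Γⁱ_{jk}(a)` of an affine connection in the charts `φ`.
The field `V` along the curve `c : [0, 1] → M` is parallel if
`dVⁱ/dt + Γⁱ_{jk}(c) (dcʲ/dt) Vᵏ = 0` in all charts. -/
def IsParallelAlong
    (Γ : OpenPartialHomeomorph M (EuclideanSpace ℝ (Fin n)) → Fin n → Fin n → Fin n →
      EuclideanSpace ℝ (Fin n) → ℝ)
    (c : ℝ → M) (V : ∀ t, TangentSpace (𝓡 n) (c t)) : Prop :=
  ∀ φ ∈ IsManifold.maximalAtlas (𝓡 n) ∞ M, ∀ t ∈ Icc (0 : ℝ) 1, c t ∈ φ.source →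
    let W : ℝ → EuclideanSpace ℝ (Fin n) := fun s => mfderiv (𝓡 n) (𝓡 n) φ (c s) (V s)
    let c' : EuclideanSpace ℝ (Fin n) := derivWithin (fun s => φ (c s)) (Icc 0 1) t
    HasDerivWithinAt W
      (WithLp.toLp 2 fun i => -∑ j, ∑ k, Γ φ i j k (φ (c t)) * c' j * W t k) (Icc 0 1) t

/-- The affine connection with coefficients `Γ` leaves invariant the family of subsets
`R x ⊆ T_x M`: parallel transport along any `C¹` curve `c` from `x` to `z` maps `R x` onto `R z`,
i.e. a parallel field along `c` starts in `R x` if and only if it ends in `R z`.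
(For `x = z` this is invariance of `R x` under the holonomy at `x`.) -/
def LeavesInvariant
    (Γ : OpenPartialHomeomorph M (EuclideanSpace ℝ (Fin n)) → Fin n → Fin n → Fin n →
      EuclideanSpace ℝ (Fin n) → ℝ)
    (R : ∀ x : M, Set (TangentSpace (𝓡 n) x)) : Prop :=
  ∀ c : ℝ → M, ContMDiffOn 𝓘(ℝ, ℝ) (𝓡 n) 1 c (Icc 0 1) →
    ∀ V : ∀ t, TangentSpace (𝓡 n) (c t), IsParallelAlong Γ c V →
      (V 0 ∈ R (c 0) ↔ V 1 ∈ R (c 1))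

/-- The components `h_{ij}` of a Riemannian metric in a chart. -/
def metricMatrix
    (h : ContMDiffRiemannianMetric (𝓡 n) ∞ (EuclideanSpace ℝ (Fin n))
      (fun x : M => TangentSpace (𝓡 n) x))
    (φ : OpenPartialHomeomorph M (EuclideanSpace ℝ (Fin n))) (a : EuclideanSpace ℝ (Fin n)) :
    Matrix (Fin n) (Fin n) ℝ :=
  Matrix.of fun i j => h.inner (φ.symm a)
    (mfderiv (𝓡 n) (𝓡 n) φ.symm a (EuclideanSpace.single i (1 : ℝ) : EuclideanSpace ℝ (Fin n)))
    (mfderiv (𝓡 n) (𝓡 n) φ.symm a (EuclideanSpace.single j (1 : ℝ) : EuclideanSpace ℝ (Fin n)))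

/-- The coefficients of the Levi-Civita connection of a Riemannian metric. -/
def leviCivita
    (h : ContMDiffRiemannianMetric (𝓡 n) ∞ (EuclideanSpace ℝ (Fin n))
      (fun x : M => TangentSpace (𝓡 n) x))
    (φ : OpenPartialHomeomorph M (EuclideanSpace ℝ (Fin n))) (i j k : Fin n)
    (a : EuclideanSpace ℝ (Fin n)) : ℝ :=
  FinslerLocal.christoffel (metricMatrix h φ a)
    (fun k => Matrix.of fun i j =>
      fderiv ℝ (fun b => metricMatrix h φ b i j) a (EuclideanSpace.single k 1)) i j k

end Parallel

/-- `K` is a compact submanifold of codimension zero (possibly with boundary) of `ℝⁿ`: it is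
compact, and near each of its points it is either a full neighbourhood or the side `{q ≤ q(p)}` of a
hypersurface given by a smooth function `q` without critical point at `p`. -/
def IsCompactCodimZero {n : ℕ} (K : Set (EuclideanSpace ℝ (Fin n))) : Prop :=
  IsCompact K ∧ ∀ p ∈ K, K ∈ nhds p ∨
    ∃ (U : Set (EuclideanSpace ℝ (Fin n))) (q : EuclideanSpace ℝ (Fin n) → ℝ),
      IsOpen U ∧ p ∈ U ∧ ContDiffOn ℝ ∞ q U ∧ fderiv ℝ q p ≠ 0 ∧
        ∀ y ∈ U, y ∈ K ↔ q y ≤ q p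

namespace FinslerStructure

variable {n : ℕ} {M : Type*} [TopologicalSpace M] [ChartedSpace (EuclideanSpace ℝ (Fin n)) M]
  [IsManifold (𝓡 n) ∞ M]

/-- The Landsberg condition `Ȧ_{ikl} = Pⁿ_{ikl} = 0`. -/
def IsLandsberg (F : FinslerStructure n M) : Prop :=
  ∀ φ ∈ IsManifold.maximalAtlas (𝓡 n) ∞ M, ∀ a ∈ φ.target,
    ∀ y : EuclideanSpace ℝ (Fin n), y ≠ 0 → ∀ i k l,
      FinslerLocal.landsberg (inNaturalCoords F.toFun φ) i k l a y = 0

/-- The coefficients of the Chern connection live on the base: near each point, they do not depend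
on `y` in suitable natural coordinates. (By the transformation law of `Γⁱ_{jk}`, whose inhomogeneous
part does not involve `y`, they then do not depend on `y` in any natural coordinates.) -/
def IsBerwald (F : FinslerStructure n M) : Prop :=
  ∀ x : M, ∃ φ ∈ IsManifold.maximalAtlas (𝓡 n) ∞ M, x ∈ φ.source ∧ ∀ a ∈ φ.target,
    ∀ y y' : EuclideanSpace ℝ (Fin n), y ≠ 0 → y' ≠ 0 → ∀ i j k,
      FinslerLocal.chern (inNaturalCoords F.toFun φ) i j k a y =
        FinslerLocal.chern (inNaturalCoords F.toFun φ) i j k a y'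

/-- Near each point there are coordinates `xⁱ` such that `F` depends on `y` only. -/
def IsLocallyMinkowski (F : FinslerStructure n M) : Prop :=
  ∀ x : M, ∃ φ ∈ IsManifold.maximalAtlas (𝓡 n) ∞ M, x ∈ φ.source ∧
    ∀ a ∈ φ.target, ∀ b ∈ φ.target, ∀ y : EuclideanSpace ℝ (Fin n),
      inNaturalCoords F.toFun φ a y = inNaturalCoords F.toFun φ b y

/-- Landsberg, but neither Berwald nor locally Minkowski. -/
def IsPureLandsberg (F : FinslerStructure n M) : Prop :=
  F.IsLandsberg ∧ ¬ (F.IsBerwald ∨ F.IsLocallyMinkowski)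

/-- The coefficients of the averaged Chern connection in the charts of `M`. -/
def averagedChern (F : FinslerStructure n M)
    (φ : OpenPartialHomeomorph M (EuclideanSpace ℝ (Fin n))) (i j k : Fin n)
    (a : EuclideanSpace ℝ (Fin n)) : ℝ :=
  FinslerLocal.averagedChern (inNaturalCoords F.toFun φ) i j k a

/-- The indicatrix `I_x = {y ∈ T_x M | F(x, y) = 1}`. -/
def indicatrix (F : FinslerStructure n M) (x : M) : Set (TangentSpace (𝓡 n) x) :=
  {y | F.toFun ⟨x, y⟩ = 1}

/-- The interpolating metric `F_t(x, y) = (1 - t) F(x, y) + t √(h_x(y, y))`. -/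
def interpolate (F : FinslerStructure n M)
    (h : ContMDiffRiemannianMetric (𝓡 n) ∞ (EuclideanSpace ℝ (Fin n))
      (fun x : M => TangentSpace (𝓡 n) x))
    (t : ℝ) (x : M) (y : TangentSpace (𝓡 n) x) : ℝ :=
  (1 - t) * F.toFun ⟨x, y⟩ + t * Real.sqrt (h.inner x y y)

/-- The indicatrix `I_x(t) = {y ∈ T_x M | F_t(x, y) = 1}` of the interpolating metric. -/
def interpIndicatrix (F : FinslerStructure n M)
    (h : ContMDiffRiemannianMetric (𝓡 n) ∞ (EuclideanSpace ℝ (Fin n))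
      (fun x : M => TangentSpace (𝓡 n) x))
    (x : M) (t : ℝ) : Set (TangentSpace (𝓡 n) x) :=
  {y | F.interpolate h t x y = 1}

/-- The subset of `T_x M` swept out by the indicatrices `I_x(t)`, `t ∈ [0, 1]`. -/
def sweptRegion (F : FinslerStructure n M)
    (h : ContMDiffRiemannianMetric (𝓡 n) ∞ (EuclideanSpace ℝ (Fin n))
      (fun x : M => TangentSpace (𝓡 n) x))
    (x : M) : Set (TangentSpace (𝓡 n) x) :=
  ⋃ t ∈ Icc (0 : ℝ) 1, F.interpIndicatrix h x t

end FinslerStructure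

end

noncomputable section

set_option linter.unusedSectionVars false

/-! The argument is by contraposition. A locally Minkowski structure is Berwald, since its Chern
coefficients vanish in the adapted charts; so it suffices to produce, on a Berwald space, a
Riemannian metric `h` satisfying the three conditions whose swept regions are preserved by the
averaged Chern connection. This is `IsBerwald.exists_metric`.

On a Berwald space the Chern connection is an affine connection on the base, and the energy `F²` is
horizontally constant for it (`dX_energy_eq_chern`), so its parallel transport is linear and
preserves `F`. A metric with this Levi-Civita connection is found by averaging over the fibres, in
the spirit of Szabó. With `u` a smooth cutoff function of `F²`, put `⟨v, w⟩ = ∫ du(v) du(w) / ∫ u`.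
The quotient is invariant under linear changes of the fibre (`fiberForm_comp`), hence intrinsic.
Horizontal constancy of `u` and integration by parts show that the form is parallel
(`fderiv_fiberForm`), and a torsion-free connection with a parallel metric is its Levi-Civita
connection (`christoffel_eq_of_parallel`). The averaged Chern connection is the same connection,
being the average of coefficients independent of the velocity (`averagedChern_eq`).

The form is then multiplied by a factor making it strictly smaller than `F²`. The factor comes from
the supremum of the form over the unit ball of `F`. As parallel transport preserves both the form
and `F`, the factor is locally constant (`isLocallyConstant_scale`), so the Levi-Civita connection
does not change; no connectedness of `M` is needed.

Once `h < F²` off zero, the interpolating indicatrices are disjoint and sweep out exactly `{1 ≤ F, h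
≤ 1}`, a compact shell with two disjoint smooth boundary faces. Parallel transport preserves `F` and
`h`, hence the shell (`parallel_invariant`). -/

/-- Points and vectors in natural coordinates. -/
abbrev Coord (n : ℕ) : Type := EuclideanSpace ℝ (Fin n)

namespace FinslerLocal

variable {n : ℕ}

/-! ### Calculus of functions of position and velocity -/

/-- Joint smoothness of a function of position and velocity. -/
def SmoothOn (q : Coord n → Coord n → ℝ) (Ω : Set (Coord n × Coord n)) : Prop :=
  ContDiffOn ℝ ∞ (fun p : Coord n × Coord n => q p.1 p.2) Ω

section Calculus

variable {Ω : Set (Coord n × Coord n)} {q r : Coord n → Coord n → ℝ} {a y : Coord n}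

theorem SmoothOn.contDiffAt (hq : SmoothOn q Ω) (hΩ : IsOpen Ω) (h : (a, y) ∈ Ω) :
    ContDiffAt ℝ ∞ (fun p : Coord n × Coord n => q p.1 p.2) (a, y) :=
  ContDiffOn.contDiffAt hq (hΩ.mem_nhds h)

theorem SmoothOn.differentiableAt (hq : SmoothOn q Ω) (hΩ : IsOpen Ω) (h : (a, y) ∈ Ω) :
    DifferentiableAt ℝ (fun p : Coord n × Coord n => q p.1 p.2) (a, y) :=
  (hq.contDiffAt hΩ h).differentiableAt (by simp)

theorem SmoothOn.hasFDerivAt_right (hq : SmoothOn q Ω) (hΩ : IsOpen Ω) (h : (a, y) ∈ Ω) :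
    HasFDerivAt (fun z => q a z)
      ((fderiv ℝ (fun p : Coord n × Coord n => q p.1 p.2) (a, y)).comp
        (ContinuousLinearMap.inr ℝ (Coord n) (Coord n))) y :=
  HasFDerivAt.comp y (f := fun z : Coord n => (a, z))
    (g := fun p : Coord n × Coord n => q p.1 p.2)
    (hq.differentiableAt hΩ h).hasFDerivAt (hasFDerivAt_prodMk_right a y)

theorem SmoothOn.hasFDerivAt_left (hq : SmoothOn q Ω) (hΩ : IsOpen Ω) (h : (a, y) ∈ Ω) :
    HasFDerivAt (fun b => q b y)
      ((fderiv ℝ (fun p : Coord n × Coord n => q p.1 p.2) (a, y)).comp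
        (ContinuousLinearMap.inl ℝ (Coord n) (Coord n))) a :=
  HasFDerivAt.comp a (f := fun b : Coord n => (b, y))
    (g := fun p : Coord n × Coord n => q p.1 p.2)
    (hq.differentiableAt hΩ h).hasFDerivAt (hasFDerivAt_prodMk_left a y)

theorem SmoothOn.dY_eq (hq : SmoothOn q Ω) (hΩ : IsOpen Ω) (h : (a, y) ∈ Ω) (i : Fin n) :
    dY i q a y = fderiv ℝ (fun p : Coord n × Coord n => q p.1 p.2) (a, y)
      (0, EuclideanSpace.single i 1) := by
  rw [dY, (hq.hasFDerivAt_right hΩ h).fderiv]; simp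

theorem SmoothOn.dX_eq (hq : SmoothOn q Ω) (hΩ : IsOpen Ω) (h : (a, y) ∈ Ω) (i : Fin n) :
    dX i q a y = fderiv ℝ (fun p : Coord n × Coord n => q p.1 p.2) (a, y)
      (EuclideanSpace.single i 1, 0) := by
  rw [dX, (hq.hasFDerivAt_left hΩ h).fderiv]; simp

theorem SmoothOn.fderiv_apply (hq : SmoothOn q Ω) (hΩ : IsOpen Ω) (v : Coord n × Coord n) :
    ContDiffOn ℝ ∞ (fun p => fderiv ℝ (fun p : Coord n × Coord n => q p.1 p.2) p v) Ω :=
  (ContDiffOn.fderiv_of_isOpen hq hΩ (m := ∞) (by simp)).clm_apply contDiffOn_const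

theorem SmoothOn.dY (hq : SmoothOn q Ω) (hΩ : IsOpen Ω) (i : Fin n) : SmoothOn (dY i q) Ω :=
  (hq.fderiv_apply hΩ (0, EuclideanSpace.single i 1)).congr fun _ hp => hq.dY_eq hΩ hp i

theorem SmoothOn.dX (hq : SmoothOn q Ω) (hΩ : IsOpen Ω) (i : Fin n) : SmoothOn (dX i q) Ω :=
  (hq.fderiv_apply hΩ (EuclideanSpace.single i 1, 0)).congr fun _ hp => hq.dX_eq hΩ hp i

theorem dY_congr (hΩ : IsOpen Ω) (h : (a, y) ∈ Ω) (hqr : ∀ b z, (b, z) ∈ Ω → q b z = r b z)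
    (i : Fin n) : dY i q a y = dY i r a y := by
  have : (fun z => q a z) =ᶠ[nhds y] fun z => r a z := by
    filter_upwards [(hΩ.preimage (Continuous.prodMk_right a)).mem_nhds h] with z hz
    exact hqr a z hz
  rw [dY, dY, this.fderiv_eq]

theorem dX_congr (hΩ : IsOpen Ω) (h : (a, y) ∈ Ω) (hqr : ∀ b z, (b, z) ∈ Ω → q b z = r b z)
    (i : Fin n) : dX i q a y = dX i r a y := by
  have : (fun b => q b y) =ᶠ[nhds a] fun b => r b y := by
    filter_upwards [(hΩ.preimage (Continuous.prodMk_left y)).mem_nhds h] with z hz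
    exact hqr z y hz
  rw [dX, dX, this.fderiv_eq]

/-- Symmetry of the second derivative on the product of positions and velocities. All commutation
rules for `dX` and `dY` reduce to it, both being the joint derivative along a fixed horizontal or
vertical vector. -/
theorem SmoothOn.fderiv_fderiv (hq : SmoothOn q Ω) (hΩ : IsOpen Ω) (h : (a, y) ∈ Ω)
    (v w : Coord n × Coord n) :
    fderiv ℝ (fun p => fderiv ℝ (fun p : Coord n × Coord n => q p.1 p.2) p v) (a, y) w =
      fderiv ℝ (fun p => fderiv ℝ (fun p : Coord n × Coord n => q p.1 p.2) p w) (a, y) v := by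
  have hd : DifferentiableAt ℝ (fderiv ℝ (fun p : Coord n × Coord n => q p.1 p.2)) (a, y) :=
    ((ContDiffOn.fderiv_of_isOpen hq hΩ (m := ∞) (by simp)).contDiffAt
      (hΩ.mem_nhds h)).differentiableAt (by simp)
  rw [fderiv_clm_apply hd (differentiableAt_const _),
    fderiv_clm_apply hd (differentiableAt_const _)]
  have := (hq.contDiffAt hΩ h).isSymmSndFDerivAt
    (by simp only [minSmoothness_of_isRCLikeNormedField]; exact_mod_cast (ENat.natCast_le_of_coe_top_le_withTop le_rfl 2))
  simpa using this w v

theorem SmoothOn.fderiv_eventually_eq {g g' : Coord n × Coord n → ℝ} (hΩ : IsOpen Ω)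
    (h : (a, y) ∈ Ω) (hg : ∀ p ∈ Ω, g p = g' p) : fderiv ℝ g (a, y) = fderiv ℝ g' (a, y) :=
  Filter.EventuallyEq.fderiv_eq (Filter.eventuallyEq_of_mem (hΩ.mem_nhds h) hg)

theorem SmoothOn.dY_dY_comm (hq : SmoothOn q Ω) (hΩ : IsOpen Ω) (h : (a, y) ∈ Ω) (i j : Fin n) :
    FinslerLocal.dY i (FinslerLocal.dY j q) a y = FinslerLocal.dY j (FinslerLocal.dY i q) a y := by
  rw [(hq.dY hΩ j).dY_eq hΩ h, (hq.dY hΩ i).dY_eq hΩ h,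
    SmoothOn.fderiv_eventually_eq hΩ h fun p hp => hq.dY_eq hΩ hp j,
    SmoothOn.fderiv_eventually_eq hΩ h fun p hp => hq.dY_eq hΩ hp i]
  exact hq.fderiv_fderiv hΩ h _ _

theorem SmoothOn.dX_dY_comm (hq : SmoothOn q Ω) (hΩ : IsOpen Ω) (h : (a, y) ∈ Ω) (i j : Fin n) :
    FinslerLocal.dX i (FinslerLocal.dY j q) a y = FinslerLocal.dY j (FinslerLocal.dX i q) a y := by
  rw [(hq.dY hΩ j).dX_eq hΩ h, (hq.dX hΩ i).dY_eq hΩ h,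
    SmoothOn.fderiv_eventually_eq hΩ h fun p hp => hq.dY_eq hΩ hp j,
    SmoothOn.fderiv_eventually_eq hΩ h fun p hp => hq.dX_eq hΩ hp i]
  exact hq.fderiv_fderiv hΩ h _ _

theorem SmoothOn.diff_right (hq : SmoothOn q Ω) (hΩ : IsOpen Ω) (h : (a, y) ∈ Ω) :
    DifferentiableAt ℝ (fun z => q a z) y := (hq.hasFDerivAt_right hΩ h).differentiableAt

theorem SmoothOn.diff_left (hq : SmoothOn q Ω) (hΩ : IsOpen Ω) (h : (a, y) ∈ Ω) :
    DifferentiableAt ℝ (fun b => q b y) a := (hq.hasFDerivAt_left hΩ h).differentiableAt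

theorem SmoothOn.mul (hq : SmoothOn q Ω) (hr : SmoothOn r Ω) :
    SmoothOn (fun b z => q b z * r b z) Ω := ContDiffOn.mul hq hr

theorem SmoothOn.dY_mul (hq : SmoothOn q Ω) (hr : SmoothOn r Ω) (hΩ : IsOpen Ω) (h : (a, y) ∈ Ω)
    (i : Fin n) : FinslerLocal.dY i (fun b z => q b z * r b z) a y =
      q a y * FinslerLocal.dY i r a y + FinslerLocal.dY i q a y * r a y := by
  simp only [FinslerLocal.dY]
  rw [fderiv_fun_mul (hq.diff_right hΩ h) (hr.diff_right hΩ h)]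
  simp; ring

theorem SmoothOn.dX_mul (hq : SmoothOn q Ω) (hr : SmoothOn r Ω) (hΩ : IsOpen Ω) (h : (a, y) ∈ Ω)
    (i : Fin n) : FinslerLocal.dX i (fun b z => q b z * r b z) a y =
      q a y * FinslerLocal.dX i r a y + FinslerLocal.dX i q a y * r a y := by
  simp only [FinslerLocal.dX]
  rw [fderiv_fun_mul (hq.diff_left hΩ h) (hr.diff_left hΩ h)]
  simp; ring

theorem dY_const_mul (c : ℝ) (i : Fin n) : dY i (fun b z => c * q b z) a y = c * dY i q a y := by
  simp only [dY]
  rcases eq_or_ne c 0 with rfl | hc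
  · simp
  · rw [show (fun z => c * q a z) = c • fun z => q a z from rfl, fderiv_const_smul_field]; simp

/-- The components of a vector. -/
theorem sum_single (v : Coord n) : ∑ i, v i • EuclideanSpace.single i (1 : ℝ) = v := by
  have := (EuclideanSpace.basisFun (Fin n) ℝ).sum_repr v
  simpa using this

theorem sum_dY (v : Coord n) : ∑ i, v i * dY i q a y = fderiv ℝ (fun z => q a z) y v := by
  conv_rhs => rw [← sum_single v]
  simp [dY]

theorem sum_dX (v : Coord n) : ∑ i, v i * dX i q a y = fderiv ℝ (fun b => q b y) a v := by
  conv_rhs => rw [← sum_single v]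
  simp [dX]

/-! ### Homogeneity -/

/-- Positive homogeneity of degree `d` in the velocity. -/
def Homog (d : ℕ) (q : Coord n → Coord n → ℝ) : Prop :=
  ∀ a y (s : ℝ), 0 < s → q a (s • y) = s ^ d * q a y

theorem Homog.dY {d : ℕ} (hq : Homog (d + 1) q) (i : Fin n) : Homog d (FinslerLocal.dY i q) := by
  intro a y s hs
  -- This form of the chain rule for dilations needs no differentiability, so neither does the
  -- lemma.
  have h1 : fderiv ℝ (fun z => q a (s • z)) y = s • fderiv ℝ (fun z => q a z) (s • y) :=
    fderiv_comp_smul (f := fun z => q a z) s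
  have h2 : (fun z => q a (s • z)) = (s ^ (d + 1)) • fun z => q a z := by
    ext z; simp [hq a z s hs]
  rw [h2, fderiv_const_smul_field] at h1
  have h3 := congrArg (fun T => T (EuclideanSpace.single i (1 : ℝ))) h1
  simp only [FinslerLocal.dY]
  simp at h3
  have : s * (fderiv ℝ (fun z => q a z) (s • y)) (EuclideanSpace.single i (1 : ℝ)) =
    s * (s ^ d * (fderiv ℝ (fun z => q a z) y) (EuclideanSpace.single i (1 : ℝ))) := by
    rw [← h3]; ring
  exact mul_left_cancel₀ hs.ne' this

/-- Euler's identity: differentiate `s ↦ q a (s • y)` at `s = 1`, once by the chain rule and once by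
homogeneity. -/
theorem Homog.euler {d : ℕ} (hq : Homog d q) (hs : SmoothOn q Ω) (hΩ : IsOpen Ω)
    (h : (a, y) ∈ Ω) : ∑ i, y i * FinslerLocal.dY i q a y = d * q a y := by
  rw [sum_dY]
  have h1 : HasDerivAt (fun s : ℝ => q a (s • y)) (fderiv ℝ (fun z => q a z) y y) 1 := by
    have hd := (hs.diff_right hΩ h).hasFDerivAt
    have hl : HasDerivAt (fun s : ℝ => s • y) y 1 := by
      simpa using (hasDerivAt_id (1 : ℝ)).smul_const y
    exact HasFDerivAt.comp_hasDerivAt (1 : ℝ) (f := fun s : ℝ => s • y)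
      (by simpa using hd) hl
  have h2 : HasDerivAt (fun s : ℝ => s ^ d * q a y) (d * q a y) 1 := by
    simpa using (hasDerivAt_pow d (1 : ℝ)).mul_const (q a y)
  have h3 : (fun s : ℝ => q a (s • y)) =ᶠ[nhds 1] fun s => s ^ d * q a y := by
    filter_upwards [lt_mem_nhds (zero_lt_one (α := ℝ))] with s hs
    exact hq a y s hs
  exact (h1.congr_of_eventuallyEq h3.symm).unique h2

end Calculus

end FinslerLocal

namespace FinslerLocal
variable {n : ℕ}

/-! ### Algebra of Christoffel symbols -/

theorem lower_raise {G : Matrix (Fin n) (Fin n) ℝ} (hG : IsUnit G.det) (X : Fin n → ℝ) (t : Fin n) :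
    ∑ i, G t i * ∑ s, G⁻¹ i s * X s = X t := by
  have := congrFun (show G.mulVec (G⁻¹.mulVec X) = X by
    rw [Matrix.mulVec_mulVec, Matrix.mul_nonsing_inv _ hG, Matrix.one_mulVec]) t
  simpa [Matrix.mulVec, dotProduct] using this

theorem raise_lower {G : Matrix (Fin n) (Fin n) ℝ} (hG : IsUnit G.det) (X : Fin n → ℝ) (t : Fin n) :
    ∑ i, G⁻¹ t i * ∑ s, G i s * X s = X t := by
  have := congrFun (show G⁻¹.mulVec (G.mulVec X) = X by
    rw [Matrix.mulVec_mulVec, Matrix.nonsing_inv_mul _ hG, Matrix.one_mulVec]) t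
  simpa [Matrix.mulVec, dotProduct] using this

theorem christoffel_contract (G : Matrix (Fin n) (Fin n) ℝ) (D : Fin n → Matrix (Fin n) (Fin n) ℝ)
    (i j : Fin n) (y : Fin n → ℝ) :
    ∑ k, christoffel G D i j k * y k =
      ∑ s, G⁻¹ i s * (1 / 2 * ∑ k, (D k s j - D s j k + D j s k) * y k) := by
  simp only [christoffel, Finset.mul_sum, Finset.sum_mul]
  rw [Finset.sum_comm]
  refine Finset.sum_congr rfl fun s _ => Finset.sum_congr rfl fun k _ => by ring

theorem christoffel_comm (G : Matrix (Fin n) (Fin n) ℝ) (D : Fin n → Matrix (Fin n) (Fin n) ℝ)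
    (hD : ∀ k i j, D k i j = D k j i) (i j k : Fin n) :
    christoffel G D i j k = christoffel G D i k j := by
  simp only [christoffel]
  congr 1
  refine Finset.sum_congr rfl fun s _ => ?_
  rw [hD s j k]; ring

/-- The Christoffel symbols of a metric `G` are the coefficients of a symmetric connection for which
`G` is parallel. -/
theorem christoffel_eq_of_parallel {G : Matrix (Fin n) (Fin n) ℝ} (hG : IsUnit G.det)
    (hs : ∀ i j, G i j = G j i)
    {D : Fin n → Matrix (Fin n) (Fin n) ℝ} {Γ : Fin n → Fin n → Fin n → ℝ}
    (hΓ : ∀ l i j, Γ l i j = Γ l j i)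
    (hD : ∀ k i j, D k i j = ∑ l, Γ l k i * G l j + ∑ l, Γ l k j * G i l) (i j k : Fin n) :
    christoffel G D i j k = Γ i j k := by
  -- Lowering and raising the index of `Γ` puts `G⁻¹` in front of both sides, so they can be
  -- compared for each `s`.
  rw [christoffel, Finset.mul_sum, ← raise_lower hG (fun l => Γ l j k) i]
  refine Finset.sum_congr rfl fun s _ => ?_
  -- Koszul's computation: of the six terms, four cancel in pairs by the symmetries of `Γ` and `G`,
  -- and the other two coincide.
  have h1 : ∑ l, Γ l k j * G s l = ∑ l, G s l * Γ l j k :=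
    Finset.sum_congr rfl fun l _ => by rw [hΓ l k j]; ring
  have h2 : ∑ l, Γ l j k * G s l = ∑ l, G s l * Γ l j k :=
    Finset.sum_congr rfl fun l _ => by ring
  have h3 : ∑ l, Γ l s j * G l k = ∑ l, Γ l j s * G l k :=
    Finset.sum_congr rfl fun l _ => by rw [hΓ l s j]
  have h4 : ∑ l, Γ l s k * G j l = ∑ l, Γ l k s * G l j :=
    Finset.sum_congr rfl fun l _ => by rw [hΓ l s k, hs j l]
  rw [hD k s j, hD s j k, hD j s k, h1, h2, h3, h4]
  ring

/-! ### Contraction of the connection coefficients with the velocity. -/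

section Contraction

variable {G : Matrix (Fin n) (Fin n) ℝ} {D C : Fin n → Matrix (Fin n) (Fin n) ℝ} {y : Fin n → ℝ}
  {f : ℝ} {N : Fin n → Fin n → ℝ}

/-- The factor `f` in the Cartan tensor cancels the division by `f`, and both terms are raised by
the same inverse matrix; what remains is linear in the derivatives of the metric. -/
theorem nonlinear_raise (hf : f ≠ 0) (S : Fin n → ℝ)
    (hN : ∀ i j, N i j = ∑ k, christoffel G D i j k * y k -
      ∑ k, (∑ l, G⁻¹ i l * (f / 2 * C k l j)) * S k / f) (i j : Fin n) :
    N i j = ∑ s, G⁻¹ i s * (1 / 2 * ∑ k, (D k s j - D s j k + D j s k) * y k -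
      1 / 2 * ∑ k, C k s j * S k) := by
  rw [hN, christoffel_contract]
  simp only [mul_sub, Finset.sum_sub_distrib]
  congr 1
  simp only [Finset.mul_sum, Finset.sum_mul, Finset.sum_div]
  rw [Finset.sum_comm]
  refine Finset.sum_congr rfl fun s _ => Finset.sum_congr rfl fun k _ => ?_
  field_simp

/-- The contraction of the Chern connection with the velocity is the non-linear connection. -/
theorem christoffel_delta_contract (hf : f ≠ 0)
    (hC : ∀ i j k, C k i j = C j i k) (hCy : ∀ i j, ∑ k, C k i j * y k = 0)
    (hN : ∀ i j, N i j = ∑ k, christoffel G D i j k * y k -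
      ∑ k, (∑ l, G⁻¹ i l * (f / 2 * C k l j)) *
        (∑ r, ∑ s, christoffel G D k r s * y r * y s) / f) (i j : Fin n) :
    ∑ k, christoffel G (fun k => Matrix.of fun i j => D k i j - ∑ l, N l k * C l i j) i j k * y k =
      N i j := by
  have hCy' : ∀ i l, ∑ k, C l i k * y k = 0 := fun i l => by
    rw [← hCy i l]; exact Finset.sum_congr rfl fun k _ => by rw [hC i k l]
  -- Contraction with `y` kills the Cartan term of `N`, leaving the quadratic expression `γ y y`.
  have hNy : ∀ l, ∑ k, N l k * y k = ∑ r, ∑ s, christoffel G D l r s * y r * y s := fun l => by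
    simp only [hN, sub_mul, Finset.sum_sub_distrib]
    have key : ∀ S : Fin n → ℝ,
        ∑ j, (∑ k, (∑ m, G⁻¹ l m * (f / 2 * C k m j)) * S k / f) * y j = 0 := fun S => by
      simp only [Finset.sum_mul, Finset.sum_div]
      rw [Finset.sum_comm]
      refine Finset.sum_eq_zero fun k _ => ?_
      rw [Finset.sum_comm]
      refine Finset.sum_eq_zero fun m _ => ?_
      have : ∀ j, G⁻¹ l m * (f / 2 * C k m j) * S k / f * y j =
        (G⁻¹ l m * (f / 2) * S k / f) * (C k m j * y j) := fun j => by ring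
      simp only [this, ← Finset.mul_sum, hCy', mul_zero]
    rw [key, sub_zero]
    refine Finset.sum_congr rfl fun r _ => ?_
    rw [Finset.sum_mul]
    exact Finset.sum_congr rfl fun s _ => by ring
  rw [christoffel_contract, nonlinear_raise hf _ hN]
  refine Finset.sum_congr rfl fun s _ => ?_
  congr 1
  rw [← mul_sub]
  congr 1
  simp only [Matrix.of_apply, sub_mul, add_mul, Finset.sum_sub_distrib, Finset.sum_add_distrib]
  -- Of the three vertical corrections in `δg`, only the one whose differentiation index is
  -- contracted with `y` survives; it is the Cartan term of `N`.
  have e1 : ∑ k, (∑ l, N l k * C l s j) * y k =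
      ∑ k, C k s j * ∑ r, ∑ t, christoffel G D k r t * y r * y t := by
    simp only [← hNy, Finset.sum_mul, Finset.mul_sum]
    rw [Finset.sum_comm]
    exact Finset.sum_congr rfl fun _ _ => Finset.sum_congr rfl fun _ _ => by ring
  have e2 : ∀ u v, ∑ k, (∑ l, N l u * C l v k) * y k = 0 := fun u v => by
    simp only [Finset.sum_mul]
    rw [Finset.sum_comm]
    refine Finset.sum_eq_zero fun l _ => ?_
    have : ∀ k, N l u * C l v k * y k = N l u * (C l v k * y k) := fun k => by ring
    simp only [this, ← Finset.mul_sum, hCy', mul_zero]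
  rw [e1, e2, e2]
  ring

/-- The horizontal derivative of the energy vanishes. -/
theorem nonlinear_energy (hG : IsUnit G.det) (hf : f ≠ 0) (hGs : ∀ i j, G i j = G j i)
    (hDs : ∀ k i j, D k i j = D k j i)
    (hCy : ∀ k j, ∑ i, C k i j * y i = 0) (S : Fin n → ℝ)
    (hN : ∀ i j, N i j = ∑ k, christoffel G D i j k * y k -
      ∑ k, (∑ l, G⁻¹ i l * (f / 2 * C k l j)) * S k / f) (k : Fin n) :
    ∑ l, N l k * (2 * ∑ m, G l m * y m) = ∑ m, ∑ r, D k m r * y m * y r := by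
  have h1 : ∀ m, ∑ l, G m l * N l k = 1 / 2 * ∑ r, (D r m k - D m k r + D k m r) * y r -
      1 / 2 * ∑ r, C r m k * S r := fun m => by
    simp only [nonlinear_raise hf S hN]
    exact lower_raise hG (fun s => 1 / 2 * ∑ r, (D r s k - D s k r + D k s r) * y r -
      1 / 2 * ∑ r, C r s k * S r) m
  have h2 : ∑ l, N l k * (2 * ∑ m, G l m * y m) = 2 * ∑ m, y m * ∑ l, G m l * N l k := by
    simp only [Finset.mul_sum]
    rw [Finset.sum_comm]
    exact Finset.sum_congr rfl fun m _ => Finset.sum_congr rfl fun l _ => by rw [hGs l m]; ring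
  -- The Cartan term drops out for every `S`, because `C` contracted with `y` vanishes.
  have h3 : ∑ m, y m * ∑ r, C r m k * S r = 0 := by
    simp only [Finset.mul_sum]
    rw [Finset.sum_comm]
    refine Finset.sum_eq_zero fun r _ => ?_
    have : ∀ m, y m * (C r m k * S r) = S r * (C r m k * y m) := fun m => by ring
    simp only [this, ← Finset.mul_sum, hCy, mul_zero]
  have h4 : ∑ m, y m * ∑ r, (D r m k - D m k r + D k m r) * y r =
      ∑ m, ∑ r, D k m r * y m * y r := by
    have e : ∑ m, ∑ r, y m * (D r m k * y r) = ∑ m, ∑ r, y m * (D m k r * y r) := by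
      rw [Finset.sum_comm]
      exact Finset.sum_congr rfl fun m _ => Finset.sum_congr rfl fun r _ => by
        rw [hDs m r k]; ring
    simp only [Finset.mul_sum, add_mul, sub_mul, mul_add, mul_sub, Finset.sum_add_distrib,
      Finset.sum_sub_distrib]
    rw [e, sub_self, zero_add]
    exact Finset.sum_congr rfl fun m _ => Finset.sum_congr rfl fun r _ => by ring
  rw [h2]
  simp only [h1, mul_sub, Finset.sum_sub_distrib]
  have h5 : ∀ X : Fin n → ℝ, ∑ m, y m * (1 / 2 * X m) = 1 / 2 * ∑ m, y m * X m := fun X => by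
    rw [Finset.mul_sum]; exact Finset.sum_congr rfl fun m _ => by ring
  rw [h5 fun m => ∑ r, (D r m k - D m k r + D k m r) * y r, h5 fun m => ∑ r, C r m k * S r, h3, h4]
  ring

end Contraction

/-! ### Finsler functions in natural coordinates -/

/-- `f` is the coordinate expression over `T` of a Finsler function. -/
structure IsFinsler (f : Coord n → Coord n → ℝ) (T : Set (Coord n)) : Prop where
  isOpen : IsOpen T
  smooth : SmoothOn f (T ×ˢ {0}ᶜ)
  nonneg : ∀ a y, 0 ≤ f a y
  homog : Homog 1 f
  posDef : ∀ a ∈ T, ∀ y ≠ 0, (fundamental f a y).PosDef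

/-- The energy `f²`. -/
def energy (f : Coord n → Coord n → ℝ) (a y : Coord n) : ℝ := f a y ^ 2

namespace IsFinsler

variable {f : Coord n → Coord n → ℝ} {T : Set (Coord n)} {a y : Coord n}

theorem isOpen_slit (hf : IsFinsler f T) : IsOpen (T ×ˢ ({0}ᶜ : Set (Coord n))) :=
  hf.isOpen.prod isOpen_compl_singleton

theorem energy_homog (hf : IsFinsler f T) : Homog 2 (energy f) := fun a y s hs => by
  simp only [energy, hf.homog a y s hs]; ring

theorem energy_smooth (hf : IsFinsler f T) : SmoothOn (energy f) (T ×ˢ {0}ᶜ) :=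
  ContDiffOn.pow hf.smooth 2

theorem fundamental_apply (f : Coord n → Coord n → ℝ) (i j : Fin n) :
    (fun b z => fundamental f b z i j) = fun b z => 1 / 2 * dY i (dY j (energy f)) b z := rfl

theorem fundamental_smooth (hf : IsFinsler f T) (i j : Fin n) :
    SmoothOn (fun b z => fundamental f b z i j) (T ×ˢ {0}ᶜ) := by
  rw [fundamental_apply]
  exact ContDiffOn.mul contDiffOn_const ((hf.energy_smooth.dY hf.isOpen_slit j).dY hf.isOpen_slit i)

theorem fundamental_symm (hf : IsFinsler f T) (ha : a ∈ T) (hy : y ≠ 0) (i j : Fin n) :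
    fundamental f a y i j = fundamental f a y j i := by
  change 1 / 2 * dY i (dY j (energy f)) a y = 1 / 2 * dY j (dY i (energy f)) a y
  rw [hf.energy_smooth.dY_dY_comm hf.isOpen_slit ⟨ha, hy⟩]

theorem fundamental_homog (hf : IsFinsler f T) (i j : Fin n) :
    Homog 0 (fun b z => fundamental f b z i j) := by
  intro a y s hs
  change 1 / 2 * dY i (dY j (energy f)) a (s • y) = s ^ 0 * (1 / 2 * dY i (dY j (energy f)) a y)
  rw [((Homog.dY (d := 1) hf.energy_homog j).dY i) a y s hs]
  ring

/-- The first velocity derivatives of the energy have degree one, so Euler's identity recovers them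
from the second derivatives, which are `2g`. -/
theorem dY_energy (hf : IsFinsler f T) (ha : a ∈ T) (hy : y ≠ 0) (i : Fin n) :
    dY i (energy f) a y = 2 * ∑ m, fundamental f a y i m * y m := by
  have h := (Homog.dY (d := 1) hf.energy_homog i).euler (hf.energy_smooth.dY hf.isOpen_slit i)
    hf.isOpen_slit (a := a) (y := y) ⟨ha, hy⟩
  simp only [Nat.cast_one, one_mul] at h
  rw [← h, Finset.mul_sum]
  refine Finset.sum_congr rfl fun m _ => ?_
  change _ = 2 * (1 / 2 * dY i (dY m (energy f)) a y * y m)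
  rw [hf.energy_smooth.dY_dY_comm hf.isOpen_slit ⟨ha, hy⟩ m i]
  ring

theorem energy_eq (hf : IsFinsler f T) (ha : a ∈ T) (hy : y ≠ 0) :
    energy f a y = ∑ i, ∑ m, fundamental f a y i m * y i * y m := by
  have h := hf.energy_homog.euler hf.energy_smooth hf.isOpen_slit (a := a) (y := y) ⟨ha, hy⟩
  simp only [hf.dY_energy ha hy] at h
  have h' : ∑ i, y i * (2 * ∑ m, fundamental f a y i m * y m) =
      2 * ∑ i, ∑ m, fundamental f a y i m * y i * y m := by
    simp only [Finset.mul_sum]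
    exact Finset.sum_congr rfl fun m _ => Finset.sum_congr rfl fun r _ => by ring
  rw [h'] at h
  push_cast at h
  linarith

/-- Positivity of `f` off the zero section is not an axiom; it follows from `f² = g_{ij} yⁱ yʲ` and
the definiteness of `g`. -/
theorem energy_pos (hf : IsFinsler f T) (ha : a ∈ T) (hy : y ≠ 0) : 0 < energy f a y := by
  rw [hf.energy_eq ha hy]
  have h := (hf.posDef a ha y hy).dotProduct_mulVec_pos (x := fun i => y i)
    (fun h => hy (by ext i; exact congrFun h i))
  simp only [dotProduct, Matrix.mulVec, star_trivial, Finset.mul_sum] at h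
  refine h.trans_eq (Finset.sum_congr rfl fun m _ => Finset.sum_congr rfl fun r _ => by ring)

theorem apply_pos (hf : IsFinsler f T) (ha : a ∈ T) (hy : y ≠ 0) : 0 < f a y := by
  refine lt_of_le_of_ne (hf.nonneg a y) fun h => ?_
  have := hf.energy_pos ha hy
  simp [energy, ← h] at this

theorem apply_zero (hf : IsFinsler f T) (a : Coord n) : f a 0 = 0 := by
  have := hf.homog a 0 2 two_pos
  rw [smul_zero] at this
  linarith

/-- Total symmetry of the Cartan tensor: it consists of third velocity derivatives of the energy. -/
theorem dY_fundamental_comm (hf : IsFinsler f T) (ha : a ∈ T) (hy : y ≠ 0) (i j k : Fin n) :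
    dY k (fun b z => fundamental f b z i j) a y = dY j (fun b z => fundamental f b z i k) a y := by
  have hΩ := hf.isOpen_slit
  have hL := hf.energy_smooth
  have h : (a, y) ∈ T ×ˢ ({0}ᶜ : Set (Coord n)) := ⟨ha, hy⟩
  rw [fundamental_apply, fundamental_apply, dY_const_mul, dY_const_mul,
    dY_congr hΩ h (fun b z hb => hL.dY_dY_comm hΩ hb i j) k,
    dY_congr hΩ h (fun b z hb => hL.dY_dY_comm hΩ hb i k) j, (hL.dY hΩ i).dY_dY_comm hΩ h]

theorem dY_fundamental_symm (hf : IsFinsler f T) (ha : a ∈ T) (hy : y ≠ 0) (i j k : Fin n) :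
    dY k (fun b z => fundamental f b z i j) a y = dY k (fun b z => fundamental f b z j i) a y :=
  dY_congr hf.isOpen_slit (show (a, y) ∈ T ×ˢ ({0}ᶜ : Set (Coord n)) from ⟨ha, hy⟩)
    (fun _ _ hb => hf.fundamental_symm hb.1 hb.2 i j) k

theorem dX_fundamental_symm (hf : IsFinsler f T) (ha : a ∈ T) (hy : y ≠ 0) (i j k : Fin n) :
    dX k (fun b z => fundamental f b z i j) a y = dX k (fun b z => fundamental f b z j i) a y :=
  dX_congr hf.isOpen_slit (show (a, y) ∈ T ×ˢ ({0}ᶜ : Set (Coord n)) from ⟨ha, hy⟩)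
    (fun _ _ hb => hf.fundamental_symm hb.1 hb.2 i j) k

/-- Euler's identity in degree zero. -/
theorem dY_fundamental_contract (hf : IsFinsler f T) (ha : a ∈ T) (hy : y ≠ 0) (i j : Fin n) :
    ∑ k, dY k (fun b z => fundamental f b z i j) a y * y k = 0 := by
  have h := (hf.fundamental_homog i j).euler (hf.fundamental_smooth i j) hf.isOpen_slit
    (a := a) (y := y) ⟨ha, hy⟩
  simpa [mul_comm] using h

theorem isUnit_det (hf : IsFinsler f T) (ha : a ∈ T) (hy : y ≠ 0) :
    IsUnit (fundamental f a y).det := (hf.posDef a ha y hy).det_pos.ne'.isUnit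

theorem dX_energy (hf : IsFinsler f T) (ha : a ∈ T) (hy : y ≠ 0) (k : Fin n) :
    dX k (energy f) a y =
      ∑ m, ∑ r, dX k (fun b z => fundamental f b z m r) a y * y m * y r := by
  rw [dX_congr hf.isOpen_slit (show (a, y) ∈ T ×ˢ ({0}ᶜ : Set (Coord n)) from ⟨ha, hy⟩)
    (fun b z hb => hf.energy_eq hb.1 hb.2) k]
  simp only [dX]
  have hd : ∀ m r, DifferentiableAt ℝ (fun b => fundamental f b y m r) a := fun m r =>
    (hf.fundamental_smooth m r).diff_left hf.isOpen_slit ⟨ha, hy⟩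
  rw [fderiv_fun_sum fun m _ => DifferentiableAt.fun_sum fun r _ =>
    ((hd m r).mul_const _).mul_const _]
  simp only [sum_apply]
  refine Finset.sum_congr rfl fun m _ => ?_
  rw [fderiv_fun_sum fun r _ => ((hd m r).mul_const _).mul_const _]
  simp only [sum_apply]
  refine Finset.sum_congr rfl fun r _ => ?_
  rw [fderiv_mul_const ((hd m r).mul_const _), fderiv_mul_const (hd m r)]
  simp only [smul_apply, smul_eq_mul]
  ring

/-- Exhibits the non-linear connection in the form required by the algebraic contraction lemmas. -/
theorem nonlinear_eq (f : Coord n → Coord n → ℝ) (a y : Coord n) (i j : Fin n) :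
    nonlinear f i j a y = ∑ k, christoffel (fundamental f a y)
        (fun k => Matrix.of fun i j => dX k (fun b z => fundamental f b z i j) a y) i j k * y k -
      ∑ k, (∑ l, (fundamental f a y)⁻¹ i l * (f a y / 2 * (fun k => Matrix.of fun i j =>
        dY k (fun b z => fundamental f b z i j) a y) k l j)) *
        (∑ r, ∑ s, christoffel (fundamental f a y)
          (fun k => Matrix.of fun i j => dX k (fun b z => fundamental f b z i j) a y) k r s
            * y r * y s) / f a y := rfl

theorem chern_contract (hf : IsFinsler f T) (ha : a ∈ T) (hy : y ≠ 0) (i j : Fin n) :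
    ∑ k, chern f i j k a y * y k = nonlinear f i j a y :=
  christoffel_delta_contract (hf.apply_pos ha hy).ne'
    (fun i j k => hf.dY_fundamental_comm ha hy i j k)
    (fun i j => hf.dY_fundamental_contract ha hy i j)
    (nonlinear_eq f a y) i j

theorem dX_energy_eq_nonlinear (hf : IsFinsler f T) (ha : a ∈ T) (hy : y ≠ 0) (k : Fin n) :
    dX k (energy f) a y = ∑ l, nonlinear f l k a y * dY l (energy f) a y := by
  simp only [hf.dX_energy ha hy, hf.dY_energy ha hy]
  refine (nonlinear_energy (hf.isUnit_det ha hy) (hf.apply_pos ha hy).ne'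
    (fun i j => hf.fundamental_symm ha hy i j)
    (fun k i j => hf.dX_fundamental_symm ha hy i j k) (fun k j => ?_) _
    (nonlinear_eq f a y) k).symm
  rw [← hf.dY_fundamental_contract ha hy k j]
  refine Finset.sum_congr rfl fun i _ => ?_
  rw [Matrix.of_apply, hf.dY_fundamental_symm ha hy, hf.dY_fundamental_comm ha hy,
    hf.dY_fundamental_symm ha hy]

theorem delta_fundamental_symm (hf : IsFinsler f T) (ha : a ∈ T) (hy : y ≠ 0) (i j k : Fin n) :
    delta f k (fun b z => fundamental f b z i j) a y =
      delta f k (fun b z => fundamental f b z j i) a y := by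
  simp only [delta, hf.dX_fundamental_symm ha hy i j, hf.dY_fundamental_symm ha hy i j]

theorem chern_comm (hf : IsFinsler f T) (ha : a ∈ T) (hy : y ≠ 0) (i j k : Fin n) :
    chern f i j k a y = chern f i k j a y :=
  christoffel_comm _ _ (fun k i j => hf.delta_fundamental_symm ha hy i j k) i j k

/-- The horizontal derivative of the energy along the Chern connection vanishes. -/
theorem dX_energy_eq_chern (hf : IsFinsler f T) (ha : a ∈ T) (hy : y ≠ 0) (k : Fin n) :
    dX k (energy f) a y = ∑ l, (∑ m, chern f l k m a y * y m) * dY l (energy f) a y := by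
  simp only [hf.chern_contract ha hy, hf.dX_energy_eq_nonlinear ha hy]

/-- If `f` does not depend on the point, the Chern connection vanishes. -/
theorem chern_eq_zero_of_minkowski (hT : IsOpen T) (hM : ∀ a ∈ T, ∀ b ∈ T, ∀ y, f a y = f b y)
    (ha : a ∈ T) (i j k : Fin n) : chern f i j k a y = 0 := by
  have hg : ∀ b ∈ T, ∀ z i j, fundamental f b z i j = fundamental f a z i j := by
    intro b hb z i j
    have h1 : ∀ j, (fun w => dY j (energy f) b w) = fun w => dY j (energy f) a w := fun j => by
      ext w
      simp only [dY, energy]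
      congr 2
      ext v
      rw [hM b hb a ha v]
    change 1 / 2 * fderiv ℝ (fun w => dY j (energy f) b w) z _ =
      1 / 2 * fderiv ℝ (fun w => dY j (energy f) a w) z _
    rw [h1]
  have hx : ∀ k i j, dX k (fun b z => fundamental f b z i j) a y = 0 := fun k i j => by
    have : (fun b => fundamental f b y i j) =ᶠ[nhds a] fun _ => fundamental f a y i j :=
      Filter.eventuallyEq_of_mem (hT.mem_nhds ha) fun b hb => hg b hb y i j
    simp [dX, this.fderiv_eq]
  have hγ : ∀ i j k, formalChristoffel f i j k a y = 0 := fun i j k => by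
    simp [formalChristoffel, christoffel, hx]
  have hN : ∀ i j, nonlinear f i j a y = 0 := fun i j => by
    simp [nonlinear, hγ]
  simp [chern, christoffel, delta, hx, hN]

end IsFinsler
end FinslerLocal

namespace FinslerLocal
variable {n : ℕ}

/-! ### A smooth bump function on the fibres -/

namespace IsFinsler

variable {f : Coord n → Coord n → ℝ} {T : Set (Coord n)} {a y : Coord n}

/-- Compactness of a closed ball times the unit sphere bounds the energy and its inverse there;
homogeneity of degree two extends the bounds to all velocities, uniformly in the base point. -/
theorem exists_energy_bounds (hf : IsFinsler f T) (ha : a ∈ T) :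
    ∃ r > 0, ∃ c > 0, Metric.closedBall a r ⊆ T ∧ ∀ b ∈ Metric.closedBall a r, ∀ y,
      c * ‖y‖ ^ 2 ≤ energy f b y ∧ energy f b y ≤ c⁻¹ * ‖y‖ ^ 2 := by
  obtain ⟨r, hr, hrT⟩ := Metric.nhds_basis_closedBall.mem_iff.1 (hf.isOpen.mem_nhds ha)
  have hK : IsCompact (Metric.closedBall a r ×ˢ Metric.sphere (0 : Coord n) 1) :=
    (isCompact_closedBall a r).prod (isCompact_sphere 0 1)
  have hsub : Metric.closedBall a r ×ˢ Metric.sphere (0 : Coord n) 1 ⊆ T ×ˢ {0}ᶜ := by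
    rintro ⟨b, z⟩ ⟨hb, hz⟩
    exact ⟨hrT hb, fun h => by simp [show z = 0 from h] at hz⟩
  have hc : ContinuousOn (fun p : Coord n × Coord n => energy f p.1 p.2)
      (Metric.closedBall a r ×ˢ Metric.sphere (0 : Coord n) 1) :=
    (ContDiffOn.continuousOn hf.energy_smooth).mono hsub
  have hpos : ∀ p ∈ Metric.closedBall a r ×ˢ Metric.sphere (0 : Coord n) 1,
      0 < energy f p.1 p.2 := fun p hp => hf.energy_pos (hsub hp).1 (hsub hp).2
  obtain ⟨C, hC⟩ := hK.exists_bound_of_continuousOn hc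
  obtain ⟨C', hC'⟩ := hK.exists_bound_of_continuousOn (hc.inv₀ fun p hp => (hpos p hp).ne')
  -- One constant bounds both the energy and its inverse; the `1` keeps it positive even when the
  -- sphere is empty.
  set D := max 1 (max C C')
  have hD : 0 < D := lt_of_lt_of_le one_pos (le_max_left _ _)
  refine ⟨r, hr, D⁻¹, inv_pos.2 hD, hrT, fun b hb y => ?_⟩
  rcases eq_or_ne y 0 with rfl | hy
  · simp [energy, hf.apply_zero]
  have hy' : 0 < ‖y‖ := norm_pos_iff.2 hy
  set z := ‖y‖⁻¹ • y
  have hz : (b, z) ∈ Metric.closedBall a r ×ˢ Metric.sphere (0 : Coord n) 1 :=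
    ⟨hb, by simp [z, norm_smul, hy'.ne']⟩
  have hyz : y = ‖y‖ • z := by simp [z, smul_smul, hy'.ne']
  have hE : energy f b y = ‖y‖ ^ 2 * energy f b z := by
    conv_lhs => rw [hyz]
    exact hf.energy_homog b z _ hy'
  have h1 : energy f b z ≤ D := (le_abs_self _).trans
    ((hC _ hz).trans ((le_max_left _ _).trans (le_max_right _ _)))
  have h2 : (energy f b z)⁻¹ ≤ D := (le_abs_self _).trans
    ((hC' _ hz).trans ((le_max_right _ _).trans (le_max_right _ _)))
  have h3 : D⁻¹ ≤ energy f b z := inv_le_of_inv_le₀ (hpos _ hz) h2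
  rw [hE, inv_inv]
  constructor
  · rw [mul_comm]; gcongr
  · rw [mul_comm D]; gcongr

end IsFinsler

/-- A smooth function of the energy that is `1` near the zero section and compactly supported in
the fibres. -/
def bump (f : Coord n → Coord n → ℝ) (a y : Coord n) : ℝ :=
  Real.smoothTransition (2 - energy f a y)

/-- Locally uniformly compact supports in the fibres. -/
def LocSupp {V : Type*} [Zero V] (G : Coord n → Coord n → V) (T : Set (Coord n)) : Prop :=
  ∀ a ∈ T, ∃ s, IsOpen s ∧ a ∈ s ∧ s ⊆ T ∧ ∃ k, IsCompact k ∧ ∀ b ∈ s, ∀ y ∉ k, G b y = 0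

/-- A family of bump functions around the origins of the fibres. -/
structure IsBump (u : Coord n → Coord n → ℝ) (T : Set (Coord n)) : Prop where
  isOpen : IsOpen T
  smooth : SmoothOn u (T ×ˢ univ)
  locSupp : LocSupp u T
  nonneg : ∀ a y, 0 ≤ u a y
  zero : ∀ a, u a 0 = 1

namespace IsFinsler

variable {f : Coord n → Coord n → ℝ} {T : Set (Coord n)} {a y : Coord n}

/-- The upper energy bound is uniform in the base point, so the energy is below `1` on a joint
neighbourhood of `(a, 0)`. There the cutoff is constant, which removes the possible non-smoothness
of `f²` on the zero section. -/
theorem bump_eventually (hf : IsFinsler f T) (ha : a ∈ T) :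
    ∀ᶠ p : Coord n × Coord n in nhds (a, 0), bump f p.1 p.2 = 1 := by
  obtain ⟨r, hr, c, hc, -, hb⟩ := hf.exists_energy_bounds ha
  have h1 : ∀ᶠ p : Coord n × Coord n in nhds (a, 0), c⁻¹ * ‖p.2‖ ^ 2 < 1 := by
    have : Continuous fun p : Coord n × Coord n => c⁻¹ * ‖p.2‖ ^ 2 := by fun_prop
    exact this.continuousAt.eventually (gt_mem_nhds (by simp))
  have h2 : ∀ᶠ p : Coord n × Coord n in nhds (a, 0), p.1 ∈ Metric.closedBall a r :=
    continuous_fst.continuousAt.eventually (Metric.closedBall_mem_nhds a hr)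
  filter_upwards [h1, h2] with p h1 h2
  exact Real.smoothTransition.one_of_one_le (by linarith [(hb p.1 h2 p.2).2])

theorem isBump (hf : IsFinsler f T) : IsBump (bump f) T where
  isOpen := hf.isOpen
  smooth := by
    rintro ⟨a, y⟩ ⟨ha, -⟩
    apply ContDiffAt.contDiffWithinAt
    rcases eq_or_ne y 0 with rfl | hy
    · exact (contDiffAt_const (c := (1 : ℝ))).congr_of_eventuallyEq (hf.bump_eventually ha)
    · exact Real.smoothTransition.contDiff.contDiffAt.comp (a, y)
        (contDiffAt_const.sub (hf.energy_smooth.contDiffAt hf.isOpen_slit ⟨ha, hy⟩))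
  locSupp := by
    intro a ha
    obtain ⟨r, hr, c, hc, hT, hb⟩ := hf.exists_energy_bounds ha
    -- The cutoff vanishes once the energy reaches `2`, which the lower bound guarantees for `c ‖y‖²
    -- ≥ 2`.
    refine ⟨Metric.ball a r, Metric.isOpen_ball, Metric.mem_ball_self hr,
      Metric.ball_subset_closedBall.trans hT, Metric.closedBall 0 (Real.sqrt (2 / c)),
      isCompact_closedBall _ _, fun b hbr y hy => ?_⟩
    apply Real.smoothTransition.zero_of_nonpos
    have h1 := (hb b (Metric.ball_subset_closedBall hbr) y).1
    have h2 : Real.sqrt (2 / c) < ‖y‖ := by simpa using hy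
    have h3 : 2 / c < ‖y‖ ^ 2 := (Real.sqrt_lt' ((Real.sqrt_nonneg _).trans_lt h2)).1 h2
    rw [div_lt_iff₀ hc] at h3
    linarith
  nonneg _ _ := Real.smoothTransition.nonneg _
  zero a := Real.smoothTransition.one_of_one_le (by simp [energy, hf.apply_zero])

/-- By the chain rule, a function of the energy inherits the linear relation between its
derivatives. On the zero section the cutoff is locally constant, so the relation for the energy is
needed only off it. -/
theorem dX_bump (hf : IsFinsler f T) (ha : a ∈ T) {N : Fin n → ℝ} {k : Fin n}
    (hN : y ≠ 0 → dX k (energy f) a y = ∑ l, N l * dY l (energy f) a y) :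
    dX k (bump f) a y = ∑ l, N l * dY l (bump f) a y := by
  rcases eq_or_ne y 0 with rfl | hy
  · have h1 : (fun b => bump f b 0) = fun _ => 1 := funext fun b => hf.isBump.zero b
    have h2 : (fun z => bump f a z) =ᶠ[nhds 0] fun _ => 1 :=
      (Continuous.prodMk_right a).continuousAt.eventually (hf.bump_eventually ha)
    simp [dX, dY, h1, h2.fderiv_eq]
  · have hd : DifferentiableAt ℝ Real.smoothTransition (2 - energy f a y) :=
      (Real.smoothTransition.contDiff (n := 1)).differentiable (by simp) _
    have hL := hf.energy_smooth
    have e1 : ∀ i, dX i (bump f) a y =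
        -deriv Real.smoothTransition (2 - energy f a y) * dX i (energy f) a y := fun i => by
      have := hd.hasDerivAt.comp_hasFDerivAt a
        ((hL.diff_left hf.isOpen_slit (show (a, y) ∈ _ from ⟨ha, hy⟩)).hasFDerivAt.const_sub 2)
      have h2 : (fun b => bump f b y) = Real.smoothTransition ∘ fun b => 2 - energy f b y := rfl
      rw [dX, h2, this.fderiv]; simp [dX]
    have e2 : ∀ i, dY i (bump f) a y =
        -deriv Real.smoothTransition (2 - energy f a y) * dY i (energy f) a y := fun i => by
      have := hd.hasDerivAt.comp_hasFDerivAt y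
        ((hL.diff_right hf.isOpen_slit (show (a, y) ∈ _ from ⟨ha, hy⟩)).hasFDerivAt.const_sub 2)
      have h2 : (fun z => bump f a z) = Real.smoothTransition ∘ fun z => 2 - energy f a z := rfl
      rw [dY, h2, this.fderiv]; simp [dY]
    simp only [e1, e2, hN hy, Finset.mul_sum]
    exact Finset.sum_congr rfl fun l _ => by ring

end IsFinsler

/-! ### Fibre integrals -/

section FiberIntegral

variable {V : Type*} [NormedAddCommGroup V] [NormedSpace ℝ V] {T : Set (Coord n)}
  {a y : Coord n}

/-- Makes the smoothness theorems for convolutions with parameters available as differentiation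
under the integral sign. -/
theorem convolution_eq_integral (G : Coord n → V) :
    (convolution (fun _ => (1 : ℝ)) G (ContinuousLinearMap.lsmul ℝ ℝ) volume) 0 = ∫ y, G y := by
  simp only [convolution, ContinuousLinearMap.lsmul_apply, one_smul, zero_sub]
  exact integral_neg_eq_self G volume

theorem contDiffOn_fiberIntegral [CompleteSpace V] {G : Coord n → Coord n → V}
    (hs : LocSupp G T) (hG : ContDiffOn ℝ ∞ (fun p : Coord n × Coord n => G p.1 p.2) (T ×ˢ univ)) :
    ContDiffOn ℝ ∞ (fun a => ∫ y, G a y) T := by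
  intro a ha
  obtain ⟨s, hso, has, hsT, k, hk, h0⟩ := hs a ha
  have := contDiffOn_convolution_right_with_param (n := ⊤) (ContinuousLinearMap.lsmul ℝ ℝ) hso hk
    (g := G) (μ := volume) (f := fun _ => (1 : ℝ)) (fun b y hb hy => h0 b hb y hy)
    (locallyIntegrable_const 1) (hG.mono (prod_mono_left hsT))
  have h2 : ContDiffAt ℝ ∞ (fun a => (convolution (fun _ => (1 : ℝ)) (G a)
      (ContinuousLinearMap.lsmul ℝ ℝ) volume) 0) a :=
    ContDiffAt.comp a (f := fun a => (a, (0 : Coord n)))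
      (this.contDiffAt ((hso.prod isOpen_univ).mem_nhds ⟨has, mem_univ _⟩))
      (contDiffAt_id.prodMk contDiffAt_const)
  simp only [convolution_eq_integral] at h2
  exact h2.contDiffWithinAt

variable {G : Coord n → Coord n → ℝ}

theorem LocSupp.hasCompactSupport (hs : LocSupp G T) (ha : a ∈ T) : HasCompactSupport (G a) := by
  obtain ⟨s, hso, has, hsT, k, hk, h0⟩ := hs a ha
  exact HasCompactSupport.intro hk fun y hy => h0 a has y hy

theorem LocSupp.dY (hs : LocSupp G T) (i : Fin n) : LocSupp (dY i G) T := by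
  intro a ha
  obtain ⟨s, hso, has, hsT, k, hk, h0⟩ := hs a ha
  refine ⟨s, hso, has, hsT, k, hk, fun b hb y hy => ?_⟩
  have : (fun z => G b z) =ᶠ[nhds y] fun _ => 0 :=
    Filter.eventuallyEq_of_mem (hk.isClosed.isOpen_compl.mem_nhds hy) fun z hz => h0 b hb z hz
  simp [FinslerLocal.dY, this.fderiv_eq]

theorem LocSupp.mul (hs : LocSupp G T) (H : Coord n → Coord n → ℝ) :
    LocSupp (fun b z => G b z * H b z) T := by
  intro a ha
  obtain ⟨s, hso, has, hsT, k, hk, h0⟩ := hs a ha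
  exact ⟨s, hso, has, hsT, k, hk, fun b hb y hy => by simp [h0 b hb y hy]⟩

theorem SmoothOn.contDiff_right (hG : SmoothOn G (T ×ˢ univ)) (ha : a ∈ T) :
    ContDiff ℝ ∞ (G a) :=
  contDiffOn_univ.1 (ContDiffOn.comp (s := univ) (f := fun z => (a, z)) hG
    (contDiff_prodMk_right a).contDiffOn fun _ _ => ⟨ha, mem_univ _⟩)

theorem fderiv_fiberIntegral (hT : IsOpen T) (hs : LocSupp G T) (hG : SmoothOn G (T ×ˢ univ))
    (ha : a ∈ T) (k : Fin n) :
    fderiv ℝ (fun a => ∫ y, G a y) a (EuclideanSpace.single k 1) = ∫ y, dX k G a y := by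
  obtain ⟨s, hso, has, hsT, K, hK, h0⟩ := hs a ha
  have hG' : ContDiffOn ℝ 1 ↿G (s ×ˢ univ) :=
    (ContDiffOn.of_le hG (by exact_mod_cast le_top)).mono (prod_mono_left hsT)
  have := hasFDerivAt_convolution_right_with_param (ContinuousLinearMap.lsmul ℝ ℝ) hso hK
    (g := G) (μ := volume) (f := fun _ => (1 : ℝ)) (fun b y hb hy => h0 b hb y hy)
    (locallyIntegrable_const 1) hG' (a, 0) has
  have h2 := HasFDerivAt.comp a (f := fun a : Coord n => (a, (0 : Coord n))) this
    (hasFDerivAt_prodMk_left a 0)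
  have h3 : ((fun q : Coord n × Coord n => (convolution (fun _ => (1 : ℝ)) (G q.1)
      (ContinuousLinearMap.lsmul ℝ ℝ) volume) q.2) ∘ fun a : Coord n => (a, (0 : Coord n))) =
      fun a => ∫ y, G a y := funext fun a => convolution_eq_integral _
  rw [h3] at h2
  have hcont : Continuous fun y => fderiv ℝ ↿G (a, y) :=
    ((hG'.continuousOn_fderiv_of_isOpen (hso.prod isOpen_univ) le_rfl).comp_continuous
      (Continuous.prodMk_right a) fun y => ⟨has, mem_univ _⟩)
  have hsupp : HasCompactSupport fun y => fderiv ℝ ↿G (a, y) := by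
    refine HasCompactSupport.intro hK fun y hy => ?_
    have : ↿G =ᶠ[nhds (a, y)] fun _ => 0 :=
      Filter.eventuallyEq_of_mem ((hso.prod hK.isClosed.isOpen_compl).mem_nhds ⟨has, hy⟩)
        fun p hp => h0 p.1 hp.1 p.2 hp.2
    simp [this.fderiv_eq]
  -- Integrability allows the operator-valued integral to be evaluated on a vector.
  have hint : Integrable fun y => fderiv ℝ ↿G (a, y) :=
    hcont.integrable_of_hasCompactSupport hsupp
  rw [h2.fderiv]
  have h4 : convolution (fun _ : Coord n => (1 : ℝ)) (fun y => fderiv ℝ ↿G (a, y))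
      ((ContinuousLinearMap.lsmul ℝ ℝ).precompR (Coord n × Coord n)) volume 0 =
      ∫ y, fderiv ℝ ↿G (a, y) := by
    rw [← convolution_eq_integral]
    simp only [convolution]
    refine integral_congr_ae (Filter.Eventually.of_forall fun y => ?_)
    ext <;> simp
  rw [ContinuousLinearMap.comp_apply, h4, ContinuousLinearMap.inl_apply,
    ContinuousLinearMap.integral_apply hint]
  refine integral_congr_ae (Filter.Eventually.of_forall fun y => ?_)
  exact (hG.dX_eq (hT.prod isOpen_univ) (show (a, y) ∈ _ from ⟨ha, mem_univ _⟩) k).symm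

/-- Integration by parts against a linear vector field. -/
theorem integral_linear_field {g : Coord n → ℝ} (hg : ContDiff ℝ 1 g) (hs : HasCompactSupport g)
    (A : Fin n → Fin n → ℝ) :
    ∫ y : Coord n, ∑ l, (∑ m, A l m * y m) * fderiv ℝ g y (EuclideanSpace.single l 1) =
      -(∑ l, A l l) * ∫ y, g y := by
  have hc : ∀ l, Continuous fun y => fderiv ℝ g y (EuclideanSpace.single l 1) := fun l =>
    (hg.continuous_fderiv one_ne_zero).clm_apply continuous_const
  have hcs : ∀ l, HasCompactSupport fun y => fderiv ℝ g y (EuclideanSpace.single l 1) := fun l =>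
    hs.fderiv_apply ℝ (EuclideanSpace.single l 1)
  have hlin : ∀ l, ∀ y : Coord n, HasFDerivAt (fun y : Coord n => ∑ m, A l m * y m)
      (∑ m, A l m • (EuclideanSpace.proj m : Coord n →L[ℝ] ℝ)) y := fun l y =>
    HasFDerivAt.fun_sum fun m _ =>
      ((EuclideanSpace.proj m : Coord n →L[ℝ] ℝ).hasFDerivAt).const_mul (A l m)
  have hlc : ∀ l, Continuous fun y : Coord n => ∑ m, A l m * y m := fun l => by fun_prop
  have hi : ∀ l, Integrable fun y : Coord n =>
      (∑ m, A l m * y m) * fderiv ℝ g y (EuclideanSpace.single l 1) := fun l =>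
    ((hlc l).mul (hc l)).integrable_of_hasCompactSupport (hcs l).mul_left
  -- Only the diagonal entries enter: the divergence of the linear field is the trace of `A`.
  have hd : ∀ l, ∀ y : Coord n, fderiv ℝ (fun y : Coord n => ∑ m, A l m * y m) y
      (EuclideanSpace.single l 1) = A l l := fun l y => by
    rw [(hlin l y).fderiv]
    simp [sum_apply]
  rw [integral_finsetSum _ fun l _ => hi l, neg_mul, Finset.sum_mul, ← Finset.sum_neg_distrib]
  refine Finset.sum_congr rfl fun l _ => ?_
  rw [integral_mul_fderiv_eq_neg_fderiv_mul_of_integrable]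
  · simp only [hd, integral_const_mul]
  · simp only [hd]
    exact (hg.continuous.integrable_of_hasCompactSupport hs).const_mul _
  · exact hi l
  · exact ((hlc l).mul hg.continuous).integrable_of_hasCompactSupport hs.mul_left
  · exact fun y _ => (hlin l y).differentiableAt
  · exact fun y _ => hg.differentiable (by simp) y

/-- The derivative of a fibre integral, in terms of horizontal derivatives. -/
theorem fderiv_fiberIntegral_horizontal (hT : IsOpen T) (hs : LocSupp G T)
    (hG : SmoothOn G (T ×ˢ univ)) (ha : a ∈ T) (k : Fin n) (A : Fin n → Fin n → ℝ)
    {H : Coord n → ℝ} (hHi : Integrable H)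
    (hH : ∀ y, dX k G a y = ∑ l, (∑ m, A l m * y m) * dY l G a y + H y) :
    fderiv ℝ (fun a => ∫ y, G a y) a (EuclideanSpace.single k 1) =
      (∫ y, H y) - (∑ l, A l l) * ∫ y, G a y := by
  have hc := hG.contDiff_right ha
  have hcs := hs.hasCompactSupport ha
  have hi : Integrable fun y : Coord n => ∑ l, (∑ m, A l m * y m) * dY l G a y := by
    refine integrable_finsetSum _ fun l _ => ?_
    refine Continuous.integrable_of_hasCompactSupport ?_
      ((hs.dY l).hasCompactSupport ha).mul_left
    exact Continuous.mul (by fun_prop)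
      ((hG.dY (hT.prod isOpen_univ) l).contDiff_right ha).continuous
  rw [fderiv_fiberIntegral hT hs hG ha]
  simp only [hH]
  rw [integral_add hi hHi]
  have := integral_linear_field (hc.of_le (by exact_mod_cast le_top)) hcs A
  have h2 : ∫ y : Coord n, ∑ l, (∑ m, A l m * y m) * dY l G a y =
    -(∑ l, A l l) * ∫ y, G a y := this
  rw [h2]; ring

end FiberIntegral

end FinslerLocal

namespace FinslerLocal
variable {n : ℕ}

/-! ### The averaged metric of a fibre -/

instance : NormedAddCommGroup (Coord n →L[ℝ] ℝ) := ContinuousLinearMap.toNormedAddCommGroup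

instance : NormedAddCommGroup (Coord n →L[ℝ] Coord n →L[ℝ] ℝ) :=
  ContinuousLinearMap.toNormedAddCommGroup

instance : NormedSpace ℝ (Coord n →L[ℝ] Coord n →L[ℝ] ℝ) :=
  ContinuousLinearMap.toNormedSpace

/-- The scalar product `⟨v, w⟩ = ∫ du(v) du(w) / ∫ u` defined by a bump function `u`. -/
def fiberForm (u : Coord n → ℝ) : Coord n →L[ℝ] Coord n →L[ℝ] ℝ :=
  (∫ y, u y)⁻¹ • ∫ y, (fderiv ℝ u y).smulRight (fderiv ℝ u y)

section FiberForm

variable {u : Coord n → ℝ}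

theorem integrable_fderiv_smulRight (hu : ContDiff ℝ 1 u) (hs : HasCompactSupport u) :
    Integrable fun y => (fderiv ℝ u y).smulRight (fderiv ℝ u y) := by
  have hc := hu.continuous_fderiv one_ne_zero
  refine Continuous.integrable_of_hasCompactSupport ?_ ?_
  · exact (ContinuousLinearMap.smulRightL ℝ (Coord n) (Coord n →L[ℝ] ℝ)).continuous₂.comp
      (hc.prodMk hc)
  · refine (hs.fderiv ℝ).mono fun y hy => ?_
    refine fun h => hy ?_
    ext; simp [h]

theorem fiberForm_apply (hu : ContDiff ℝ 1 u) (hs : HasCompactSupport u) (v w : Coord n) :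
    fiberForm u v w = (∫ y, u y)⁻¹ * ∫ y, fderiv ℝ u y v * fderiv ℝ u y w := by
  have hi := integrable_fderiv_smulRight hu hs
  have hi' : Integrable fun y => (fderiv ℝ u y).smulRight (fderiv ℝ u y) v :=
    hi.apply_continuousLinearMap v
  simp only [fiberForm, smul_apply, smul_eq_mul]
  rw [ContinuousLinearMap.integral_apply hi, ContinuousLinearMap.integral_apply hi']
  simp

theorem fiberForm_symm (hu : ContDiff ℝ 1 u) (hs : HasCompactSupport u) (v w : Coord n) :
    fiberForm u v w = fiberForm u w v := by
  simp only [fiberForm_apply hu hs, mul_comm]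

theorem integral_bump_pos (hu : Continuous u) (hs : HasCompactSupport u) (h0 : ∀ y, 0 ≤ u y)
    {y : Coord n} (hy : u y ≠ 0) : 0 < ∫ y, u y :=
  hu.integral_pos_of_hasCompactSupport_nonneg_nonzero hs h0 hy

/-- If `du(v)` vanished everywhere, `u` would equal `1` on the whole line spanned by `v`, contrary
to compact support. -/
theorem fiberForm_pos (hu : ContDiff ℝ 1 u) (hs : HasCompactSupport u) (h0 : ∀ y, 0 ≤ u y)
    (h1 : u 0 = 1) {v : Coord n} (hv : v ≠ 0) : 0 < fiberForm u v v := by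
  rw [fiberForm_apply hu hs]
  refine mul_pos (inv_pos.2 (integral_bump_pos hu.continuous hs h0 (y := 0) (by simp [h1]))) ?_
  have hc : Continuous fun y => fderiv ℝ u y v :=
    (hu.continuous_fderiv one_ne_zero).clm_apply continuous_const
  obtain ⟨y, hy⟩ : ∃ y, fderiv ℝ u y v ≠ 0 := by
    by_contra! h
    have hd : ∀ s : ℝ, HasDerivAt (fun s : ℝ => u (s • v)) 0 s := fun s => by
      have h2 : HasDerivAt (fun s : ℝ => s • v) v s := by
        simpa using (hasDerivAt_id s).smul_const v
      have := ((hu.differentiable one_ne_zero (s • v)).hasFDerivAt).comp_hasDerivAt s h2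
      rwa [h] at this
    have hconst : ∀ s : ℝ, u (s • v) = 1 := fun s => by
      rw [← h1, ← zero_smul ℝ v]
      exact is_const_of_deriv_eq_zero (fun s => (hd s).differentiableAt) (fun s => (hd s).deriv) s 0
    obtain ⟨R, hR⟩ := hs.isCompact.isBounded.exists_norm_le
    have hv' : 0 < ‖v‖ := norm_pos_iff.2 hv
    have hR0 : 0 ≤ R := (norm_nonneg _).trans (hR 0 (subset_tsupport _ (by simp [h1])))
    -- A point of the line of norm `R + 1`, outside the ball of radius `R` that contains the
    -- support.
    have := hR (((R + 1) / ‖v‖) • v) (subset_tsupport _ (by simp [hconst]))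
    rw [norm_smul, Real.norm_of_nonneg (by positivity), div_mul_cancel₀ _ hv'.ne'] at this
    linarith
  exact (hc.mul hc).integral_pos_of_hasCompactSupport_nonneg_nonzero
    (hs.fderiv_apply ℝ v).mul_left (fun y => mul_self_nonneg _) (mul_self_ne_zero.2 hy)

theorem integral_comp_linear (A : Coord n ≃L[ℝ] Coord n) (g : Coord n → ℝ) :
    ∫ y, g (A y) = |(LinearMap.det (A : Coord n →ₗ[ℝ] Coord n))⁻¹| * ∫ y, g y := by
  have hdet : LinearMap.det (A : Coord n →ₗ[ℝ] Coord n) ≠ 0 :=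
    (A.toLinearEquiv.isUnit_det').ne_zero
  have h1 : ∫ y, g (A y) = ∫ y, g y ∂(Measure.map A volume) :=
    (A.toHomeomorph.measurableEmbedding.integral_map g).symm
  have h2 := Measure.map_linearMap_addHaar_eq_smul_addHaar (volume : Measure (Coord n)) hdet
  have h3 : (Measure.map A volume : Measure (Coord n)) =
    Measure.map (A : Coord n →ₗ[ℝ] Coord n) volume := rfl
  rw [h1, h3, h2, integral_smul_measure, ENNReal.toReal_ofReal (abs_nonneg _), smul_eq_mul]

/-- Numerator and denominator acquire the same Jacobian factor, which cancels; this is the purpose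
of dividing by `∫ u`. -/
theorem fiberForm_comp (hu : ContDiff ℝ 1 u) (hs : HasCompactSupport u)
    (A : Coord n ≃L[ℝ] Coord n) (v w : Coord n) :
    fiberForm (fun y => u (A y)) v w = fiberForm u (A v) (A w) := by
  have hd : ∀ y, fderiv ℝ (fun y => u (A y)) y = (fderiv ℝ u (A y)).comp (A : Coord n →L[ℝ] Coord n) :=
    fun y => A.comp_right_fderiv (f := u)
  have hdet : LinearMap.det (A : Coord n →ₗ[ℝ] Coord n) ≠ 0 :=
    (A.toLinearEquiv.isUnit_det').ne_zero
  rw [fiberForm_apply (u := fun y => u (A y)) (hu.comp A.contDiff)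
    (hs.comp_homeomorph A.toHomeomorph), fiberForm_apply hu hs, integral_comp_linear A u]
  simp only [hd, ContinuousLinearMap.comp_apply, ContinuousLinearEquiv.coe_coe]
  rw [integral_comp_linear A fun y => fderiv ℝ u y (A v) * fderiv ℝ u y (A w)]
  have : |(LinearMap.det (A : Coord n →ₗ[ℝ] Coord n))⁻¹| ≠ 0 := abs_ne_zero.2 (inv_ne_zero hdet)
  rw [mul_inv]
  field_simp

end FiberForm

/-! ### Dependence of the averaged scalar product on the base point. -/

namespace IsBump

variable {u : Coord n → Coord n → ℝ} {T : Set (Coord n)} {a : Coord n}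

theorem contDiff_fiber (hu : IsBump u T) (ha : a ∈ T) : ContDiff ℝ 1 (u a) :=
  (hu.smooth.contDiff_right ha).of_le (by exact_mod_cast le_top)

theorem hasCompactSupport (hu : IsBump u T) (ha : a ∈ T) : HasCompactSupport (u a) :=
  hu.locSupp.hasCompactSupport ha

theorem integral_pos (hu : IsBump u T) (ha : a ∈ T) : 0 < ∫ y, u a y :=
  integral_bump_pos (hu.contDiff_fiber ha).continuous (hu.hasCompactSupport ha) (hu.nonneg a)
    (y := 0) (by simp [hu.zero])

theorem fiberForm_apply (hu : IsBump u T) (ha : a ∈ T) (v w : Coord n) :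
    fiberForm (u a) v w = (∫ y, u a y)⁻¹ * ∫ y, fderiv ℝ (u a) y v * fderiv ℝ (u a) y w :=
  FinslerLocal.fiberForm_apply (hu.contDiff_fiber ha) (hu.hasCompactSupport ha) v w

theorem contDiffOn_fiberForm (hu : IsBump u T) : ContDiffOn ℝ ∞ (fun a => fiberForm (u a)) T := by
  have hΩ : IsOpen (T ×ˢ (univ : Set (Coord n))) := hu.isOpen.prod isOpen_univ
  have hd : ContDiffOn ℝ ∞ (fun p : Coord n × Coord n => fderiv ℝ (u p.1) p.2) (T ×ˢ univ) := by
    have : ContDiffOn ℝ ∞ (fun p : Coord n × Coord n =>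
        (fderiv ℝ (fun p : Coord n × Coord n => u p.1 p.2) p).comp
          (ContinuousLinearMap.inr ℝ (Coord n) (Coord n))) (T ×ˢ univ) :=
      (ContDiffOn.fderiv_of_isOpen hu.smooth hΩ (m := ∞) (by simp)).clm_comp contDiffOn_const
    exact this.congr fun p hp => (hu.smooth.hasFDerivAt_right hΩ hp).fderiv
  refine ContDiffOn.smul (ContDiffOn.inv (contDiffOn_fiberIntegral hu.locSupp hu.smooth)
    fun a ha => (hu.integral_pos ha).ne') ?_
  refine contDiffOn_fiberIntegral
    (G := fun a y => (fderiv ℝ (u a) y).smulRight (fderiv ℝ (u a) y)) ?_ ?_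
  · intro a ha
    obtain ⟨s, hso, has, hsT, k, hk, h0⟩ := hu.locSupp a ha
    refine ⟨s, hso, has, hsT, k, hk, fun b hb y hy => ?_⟩
    have : u b =ᶠ[nhds y] fun _ => 0 :=
      Filter.eventuallyEq_of_mem (hk.isClosed.isOpen_compl.mem_nhds hy) fun z hz => h0 b hb z hz
    ext; simp [this.fderiv_eq]
  · exact (ContinuousLinearMap.smulRightL ℝ (Coord n) (Coord n →L[ℝ] ℝ)).isBoundedBilinearMap
      |>.contDiff.comp_contDiffOn (hd.prodMk hd)

variable {Γ : Fin n → Fin n → Fin n → Coord n → ℝ}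

/-- Obtained by differentiating the transport identity in `yⁱ`: its coefficient is linear in the
velocity and contributes the extra term, by which `du` behaves as a covector. -/
theorem dX_dY (hu : IsBump u T)
    (hX : ∀ b ∈ T, ∀ y k, dX k u b y = ∑ l, (∑ m, Γ l k m b * y m) * dY l u b y)
    (ha : a ∈ T) (y : Coord n) (i k : Fin n) :
    dX k (dY i u) a y = ∑ l, (∑ m, Γ l k m a * y m) * dY l (dY i u) a y +
      ∑ l, Γ l k i a * dY l u a y := by
  have hΩ : IsOpen (T ×ˢ (univ : Set (Coord n))) := hu.isOpen.prod isOpen_univ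
  have hm : (a, y) ∈ T ×ˢ (univ : Set (Coord n)) := ⟨ha, mem_univ _⟩
  rw [hu.smooth.dX_dY_comm hΩ hm, dY_congr hΩ hm (fun b z hb => hX b hb.1 z k) i,
    ← Finset.sum_add_distrib]
  have hlin : ∀ l, HasFDerivAt (fun y : Coord n => ∑ m, Γ l k m a * y m)
      (∑ m, Γ l k m a • (EuclideanSpace.proj m : Coord n →L[ℝ] ℝ)) y := fun l =>
    HasFDerivAt.fun_sum fun m _ =>
      ((EuclideanSpace.proj m : Coord n →L[ℝ] ℝ).hasFDerivAt).const_mul (Γ l k m a)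
  have hd : ∀ l, DifferentiableAt ℝ
      (fun z => fderiv ℝ (fun z => u a z) z (EuclideanSpace.single l 1)) y := fun l =>
    (hu.smooth.dY hΩ l).diff_right hΩ hm
  simp only [dY]
  have hmul : ∀ l, DifferentiableAt ℝ (fun z : Coord n => (∑ m, Γ l k m a * z m) *
      fderiv ℝ (fun z => u a z) z (EuclideanSpace.single l 1)) y := fun l =>
    (hlin l).differentiableAt.mul (hd l)
  rw [fderiv_fun_sum fun l _ => hmul l, sum_apply]
  refine Finset.sum_congr rfl fun l _ => ?_
  rw [fderiv_fun_mul (hlin l).differentiableAt (hd l), (hlin l).fderiv]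
  have hcomm : fderiv ℝ (fun z => dY l u a z) y (EuclideanSpace.single i 1) =
    fderiv ℝ (fun z => dY i u a z) y (EuclideanSpace.single l 1) :=
      hu.smooth.dY_dY_comm hΩ hm i l
  have hcomm' : fderiv ℝ (fun z => fderiv ℝ (fun z => u a z) z (EuclideanSpace.single l 1)) y
      (EuclideanSpace.single i 1) = fderiv ℝ (fun z => fderiv ℝ (fun z => u a z) z
        (EuclideanSpace.single i 1)) y (EuclideanSpace.single l 1) := hcomm
  simp only [add_apply, smul_apply, smul_eq_mul, sum_apply, hcomm']
  simp
  ring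

/-- The averaged metric of a family of bump functions which is constant along a connection is
parallel for this connection. -/
theorem fderiv_fiberForm (hu : IsBump u T)
    (hX : ∀ b ∈ T, ∀ y k, dX k u b y = ∑ l, (∑ m, Γ l k m b * y m) * dY l u b y)
    (ha : a ∈ T) (i j k : Fin n) :
    fderiv ℝ (fun b => fiberForm (u b) (EuclideanSpace.single i 1) (EuclideanSpace.single j 1)) a
        (EuclideanSpace.single k 1) =
      ∑ l, Γ l k i a * fiberForm (u a) (EuclideanSpace.single l 1) (EuclideanSpace.single j 1) +
      ∑ l, Γ l k j a * fiberForm (u a) (EuclideanSpace.single i 1) (EuclideanSpace.single l 1) := by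
  have hΩ : IsOpen (T ×ˢ (univ : Set (Coord n))) := hu.isOpen.prod isOpen_univ
  have hsm : ∀ i j, SmoothOn (fun b z => dY i u b z * dY j u b z) (T ×ˢ univ) := fun i j =>
    (hu.smooth.dY hΩ i).mul (hu.smooth.dY hΩ j)
  have hls : ∀ i j, LocSupp (fun b z => dY i u b z * dY j u b z) T := fun i j =>
    (hu.locSupp.dY i).mul _
  have hint : ∀ i j, Integrable fun z => dY i u a z * dY j u a z := fun i j =>
    ((hsm i j).contDiff_right ha).continuous.integrable_of_hasCompactSupport
      ((hls i j).hasCompactSupport ha)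
  have hform : ∀ i j, ∀ b ∈ T, fiberForm (u b) (EuclideanSpace.single i 1)
      (EuclideanSpace.single j 1) = (∫ y, u b y)⁻¹ * ∫ y, dY i u b y * dY j u b y :=
    fun i j b hb => hu.fiberForm_apply hb _ _
  have hev : (fun b => fiberForm (u b) (EuclideanSpace.single i 1) (EuclideanSpace.single j 1))
      =ᶠ[nhds a] fun b => (∫ y, u b y)⁻¹ * ∫ y, dY i u b y * dY j u b y :=
    Filter.eventuallyEq_of_mem (hu.isOpen.mem_nhds ha) (hform i j)
  -- The total mass `∫ u` changes only through the divergence of the transporting field.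
  have hm := fderiv_fiberIntegral_horizontal hu.isOpen hu.locSupp hu.smooth ha k
    (fun l m => Γ l k m a) (H := fun _ => 0) (integrable_zero _ _ _)
    (fun y => by simp [hX a ha y k])
  -- For the numerator, `H` collects the covector terms that the product rule yields for each of the
  -- two factors.
  have hS := fderiv_fiberIntegral_horizontal hu.isOpen (hls i j) (hsm i j) ha k
    (fun l m => Γ l k m a)
    (H := fun y => ∑ l, Γ l k i a * (dY l u a y * dY j u a y) +
      ∑ l, Γ l k j a * (dY i u a y * dY l u a y))
    ((integrable_finsetSum _ fun l _ => (hint l j).const_mul _).add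
      (integrable_finsetSum _ fun l _ => (hint i l).const_mul _)) (fun y => by
      have hmem : (a, y) ∈ T ×ˢ (univ : Set (Coord n)) := ⟨ha, mem_univ _⟩
      rw [(hu.smooth.dY hΩ i).dX_mul (hu.smooth.dY hΩ j) hΩ hmem,
        hu.dX_dY hX ha y i k, hu.dX_dY hX ha y j k]
      obtain ⟨K, hK⟩ : ∃ K : Fin n → ℝ, ∀ l, ∑ m, Γ l k m a * y m = K l := ⟨_, fun _ => rfl⟩
      simp only [hK, (hu.smooth.dY hΩ i).dY_mul (hu.smooth.dY hΩ j) hΩ hmem, mul_add, add_mul,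
        Finset.mul_sum, Finset.sum_mul, Finset.sum_add_distrib]
      have e : ∀ A B C D A' B' C' D' : ℝ, A = A' → B = B' → C = C' → D = D' →
        (A + B) + (C + D) = A' + C' + (D' + B') := by intros; subst_vars; ring
      refine e _ _ _ _ _ _ _ _ ?_ ?_ ?_ ?_ <;>
      · refine Finset.sum_congr rfl fun l _ => ?_
        ring)
  rw [integral_zero, zero_sub] at hm
  rw [integral_add (integrable_finsetSum _ fun l _ => (hint l j).const_mul _)
      (integrable_finsetSum _ fun l _ => (hint i l).const_mul _),
    integral_finsetSum _ fun l _ => (hint l j).const_mul _,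
    integral_finsetSum _ fun l _ => (hint i l).const_mul _] at hS
  simp only [integral_const_mul] at hS
  have hdm : DifferentiableAt ℝ (fun b => ∫ y, u b y) a :=
    ((contDiffOn_fiberIntegral hu.locSupp hu.smooth).contDiffAt
      (hu.isOpen.mem_nhds ha)).differentiableAt (by simp)
  have hdS : DifferentiableAt ℝ (fun b => ∫ y, dY i u b y * dY j u b y) a :=
    ((contDiffOn_fiberIntegral (hls i j) (hsm i j)).contDiffAt
      (hu.isOpen.mem_nhds ha)).differentiableAt (by simp)
  have hm0 : (∫ y, u a y) ≠ 0 := (hu.integral_pos ha).ne'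
  -- In the quotient rule the traces coming from numerator and denominator cancel, leaving exactly
  -- the terms of a parallel form.
  have hinv := (hasDerivAt_inv hm0).comp_hasFDerivAt a hdm.hasFDerivAt
  have hprod := hinv.mul hdS.hasFDerivAt
  have hev2 : (fun b => (∫ y, u b y)⁻¹ * ∫ y, dY i u b y * dY j u b y) =
    (Inv.inv ∘ fun b => ∫ y, u b y) * fun b => ∫ y, dY i u b y * dY j u b y := rfl
  rw [hev.fderiv_eq, hev2, hprod.fderiv]
  simp only [add_apply, smul_apply, smul_eq_mul, hm, hS, Function.comp_apply,
    hform _ _ a ha]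
  set M := ∫ y, u a y
  set S := ∫ y, dY i u a y * dY j u a y
  have e1 : ∀ (c : Fin n → ℝ) (X : Fin n → ℝ), ∑ l, c l * (M⁻¹ * X l) = M⁻¹ * ∑ l, c l * X l :=
    fun c X => by rw [Finset.mul_sum]; exact Finset.sum_congr rfl fun l _ => by ring
  rw [e1 (fun l => Γ l k i a) fun l => ∫ y, dY l u a y * dY j u a y,
    e1 (fun l => Γ l k j a) fun l => ∫ y, dY i u a y * dY l u a y]
  field_simp
  ring

end IsBump

end FinslerLocal

/-! ### Finsler functions in the charts of a manifold -/

section Charts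

variable {n : ℕ} {M : Type*} [TopologicalSpace M] [ChartedSpace (Coord n) M]
  [IsManifold (𝓡 n) ∞ M] {φ : OpenPartialHomeomorph M (Coord n)} {a : Coord n} {x : M}

theorem mdifferentiable_of_mem_maximalAtlas (hφ : φ ∈ IsManifold.maximalAtlas (𝓡 n) ∞ M) :
    φ.MDifferentiable (𝓡 n) (𝓡 n) :=
  ⟨(contMDiffOn_of_mem_maximalAtlas hφ).mdifferentiableOn (by simp),
    (contMDiffOn_symm_of_mem_maximalAtlas hφ).mdifferentiableOn (by simp)⟩

/-- The derivative of the inverse of a chart. -/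
def chartEquiv (hφ : φ ∈ IsManifold.maximalAtlas (𝓡 n) ∞ M) (ha : a ∈ φ.target) :
    Coord n ≃L[ℝ] Coord n :=
  (mdifferentiable_of_mem_maximalAtlas hφ).symm.mfderiv (x := a) ha

theorem mfderiv_symm_mfderiv (hφ : φ ∈ IsManifold.maximalAtlas (𝓡 n) ∞ M) (hx : x ∈ φ.source)
    (v : TangentSpace (𝓡 n) x) :
    (mfderiv (𝓡 n) (𝓡 n) φ.symm (φ x) (mfderiv (𝓡 n) (𝓡 n) φ x v) : Coord n) = v :=
  congrArg (fun T => T v) ((mdifferentiable_of_mem_maximalAtlas hφ).symm_comp_deriv hx)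

theorem totalSpace_mk_congr {p : M} (h : p = x) (v : Coord n) :
    (⟨p, v⟩ : TangentBundle (𝓡 n) M) = ⟨x, v⟩ := by
  subst h; rfl

theorem inNaturalCoords_chart (F : TangentBundle (𝓡 n) M → ℝ)
    (hφ : φ ∈ IsManifold.maximalAtlas (𝓡 n) ∞ M) (hx : x ∈ φ.source) (v : TangentSpace (𝓡 n) x) :
    inNaturalCoords F φ (φ x) (mfderiv (𝓡 n) (𝓡 n) φ x v) = F ⟨x, v⟩ := by
  have h1 := mfderiv_symm_mfderiv hφ hx v
  have h2 := totalSpace_mk_congr (φ.left_inv hx)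
    (mfderiv (𝓡 n) (𝓡 n) φ.symm (φ x) (mfderiv (𝓡 n) (𝓡 n) φ x v) : Coord n)
  exact congrArg F
    (h2.trans (congrArg (fun w : Coord n => (⟨x, w⟩ : TangentBundle (𝓡 n) M)) h1))

/-- The map is the tangent map of the inverse chart, after identifying the tangent bundle of the
model space with a product. -/
theorem smooth_chart_symm (hφ : φ ∈ IsManifold.maximalAtlas (𝓡 n) ∞ M) :
    ContMDiffOn 𝓘(ℝ, Coord n × Coord n) (𝓡 n).tangent ∞
      (fun p : Coord n × Coord n =>
        (⟨φ.symm p.1, mfderiv (𝓡 n) (𝓡 n) φ.symm p.1 p.2⟩ : TangentBundle (𝓡 n) M))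
      (φ.target ×ˢ univ) := by
  have h1 := (contMDiffOn_symm_of_mem_maximalAtlas hφ).contMDiffOn_tangentMapWithin
    (m := ∞) (by simp) φ.open_target.uniqueMDiffOn
  have h2 : ContMDiff 𝓘(ℝ, Coord n × Coord n) (𝓡 n).tangent ∞
      (fun p : Coord n × Coord n => (⟨p.1, p.2⟩ : TangentBundle (𝓡 n) (Coord n))) := by
    have := contMDiff_tangentBundleModelSpaceHomeomorph_symm (I := 𝓡 n) (n := ∞)
    rw [modelWithCornersSelf_prod]
    exact this
  have h3 := h1.comp (h2.contMDiffOn (s := φ.target ×ˢ univ)) fun p hp => hp.1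
  refine h3.congr fun p hp => ?_
  simp only [Function.comp_apply]
  rw [tangentMapWithin_eq_tangentMap (φ.open_target.uniqueMDiffOn _ hp.1)
    ((mdifferentiable_of_mem_maximalAtlas hφ).mdifferentiableAt_symm hp.1)]
  rfl

namespace FinslerStructure

open FinslerLocal

/-- A Finsler structure in the natural coordinates of a chart. -/
theorem isFinsler (F : FinslerStructure n M) (hφ : φ ∈ IsManifold.maximalAtlas (𝓡 n) ∞ M) :
    IsFinsler (inNaturalCoords F.toFun φ) φ.target where
  isOpen := φ.open_target
  smooth := by
    have h := F.smooth.comp ((smooth_chart_symm hφ).mono (prod_mono_right (subset_univ {0}ᶜ)))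
      (fun p hp => ?_)
    · exact h.contDiffOn
    · intro h0
      -- The derivative of the inverse chart is injective, so nonzero coordinates give a nonzero
      -- tangent vector.
      refine hp.2 ((chartEquiv hφ hp.1).injective ?_)
      rw [map_zero]
      exact h0
  nonneg a y := F.nonneg _
  homog a y s hs := by
    simp only [inNaturalCoords, pow_one]
    rw [← F.homogeneous _ _ s hs]
    congr 2
    exact map_smul (mfderiv (𝓡 n) (𝓡 n) φ.symm a) s y
  posDef a ha y hy := F.convex φ hφ a ha y hy

end FinslerStructure

end Charts

/-! ### The averaged Riemannian metric -/

/-- The inverse of `v ↦ B v v` is bounded on the compact unit sphere; homogeneity does the rest. -/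
theorem exists_pos_mul_norm_sq_le {n : ℕ} (B : Coord n →L[ℝ] Coord n →L[ℝ] ℝ)
    (hB : ∀ v ≠ 0, 0 < B v v) : ∃ c > 0, ∀ v, c * ‖v‖ ^ 2 ≤ B v v := by
  have hc : Continuous fun v => B v v := B.continuous.clm_apply continuous_id
  have h0 : ∀ v ∈ Metric.sphere (0 : Coord n) 1, B v v ≠ 0 := fun v hv =>
    (hB v fun h => by simp [h] at hv).ne'
  obtain ⟨C, hC⟩ := (isCompact_sphere (0 : Coord n) 1).exists_bound_of_continuousOn
    (hc.continuousOn.inv₀ h0)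
  refine ⟨(max 1 C)⁻¹, inv_pos.2 (lt_max_of_lt_left one_pos), fun v => ?_⟩
  rcases eq_or_ne v 0 with rfl | hv
  · simp
  have hv' : 0 < ‖v‖ := norm_pos_iff.2 hv
  have hz : ‖v‖⁻¹ • v ∈ Metric.sphere (0 : Coord n) 1 := by simp [norm_smul, hv'.ne']
  have h1 := inv_le_of_inv_le₀ (hB _ fun h => by simp [h] at hz)
    ((le_abs_self _).trans ((hC _ hz).trans (le_max_right 1 C)))
  have h2 : B v v = ‖v‖ ^ 2 * B (‖v‖⁻¹ • v) (‖v‖⁻¹ • v) := by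
    simp only [map_smul, smul_apply, smul_eq_mul]
    field_simp
  rw [h2, mul_comm]
  gcongr

theorem isVonNBounded_lt_one {n : ℕ} (B : Coord n →L[ℝ] Coord n →L[ℝ] ℝ)
    (hB : ∀ v ≠ 0, 0 < B v v) : Bornology.IsVonNBounded ℝ {v : Coord n | B v v < 1} := by
  obtain ⟨c, hc, h⟩ := exists_pos_mul_norm_sq_le B hB
  refine Bornology.IsVonNBounded.subset ?_
    (NormedSpace.isVonNBounded_closedBall ℝ (Coord n) (Real.sqrt c⁻¹))
  intro v hv
  have h1 : c * ‖v‖ ^ 2 < 1 := (h v).trans_lt hv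
  rw [mem_closedBall_zero_iff]
  refine Real.le_sqrt_of_sq_le ?_
  rw [← one_div, le_div_iff₀ hc]
  linarith

namespace FinslerStructure

open FinslerLocal

variable {n : ℕ} {M : Type*} [TopologicalSpace M] [ChartedSpace (Coord n) M]
  [IsManifold (𝓡 n) ∞ M] {φ : OpenPartialHomeomorph M (Coord n)} {a : Coord n}

/-- The bump function of a Finsler structure on a tangent space. -/
def fiberBump (F : FinslerStructure n M) (x : M) (y : Coord n) : ℝ :=
  Real.smoothTransition (2 - F.toFun ⟨x, y⟩ ^ 2)

/-- The averaged scalar product on a tangent space. -/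
def avgForm (F : FinslerStructure n M) (x : M) : Coord n →L[ℝ] Coord n →L[ℝ] ℝ :=
  fiberForm (F.fiberBump x)

theorem bump_eq_fiberBump (F : FinslerStructure n M)
    (hφ : φ ∈ IsManifold.maximalAtlas (𝓡 n) ∞ M) (ha : a ∈ φ.target) :
    bump (inNaturalCoords F.toFun φ) a = fun y => F.fiberBump (φ.symm a) (chartEquiv hφ ha y) := rfl

theorem fiberBump_regular (F : FinslerStructure n M) (x : M) :
    ContDiff ℝ 1 (F.fiberBump x) ∧ HasCompactSupport (F.fiberBump x) := by
  have hφ := IsManifold.chart_mem_maximalAtlas (I := 𝓡 n) (n := ∞) x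
  have ha := mem_chart_target (Coord n) x
  have hb := (F.isFinsler hφ).isBump
  set A := chartEquiv hφ ha
  have h : F.fiberBump x = fun y =>
      bump (inNaturalCoords F.toFun (chartAt (Coord n) x)) (chartAt (Coord n) x x) (A.symm y) := by
    rw [F.bump_eq_fiberBump hφ ha, (chartAt (Coord n) x).left_inv (mem_chart_source _ x)]
    ext y
    simp only [A, ContinuousLinearEquiv.apply_symm_apply]
  rw [h]
  exact ⟨(hb.contDiff_fiber ha).comp A.symm.contDiff,
    (hb.hasCompactSupport ha).comp_homeomorph A.symm.toHomeomorph⟩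

theorem apply_zero (F : FinslerStructure n M) (x : M) : F.toFun ⟨x, (0 : Coord n)⟩ = 0 := by
  have := F.homogeneous x 0 2 two_pos
  rw [smul_zero] at this
  change F.toFun ⟨x, (0 : Coord n)⟩ = 2 * F.toFun ⟨x, (0 : Coord n)⟩ at this
  linarith

theorem fiberBump_zero (F : FinslerStructure n M) (x : M) : F.fiberBump x 0 = 1 := by
  rw [fiberBump, F.apply_zero]
  exact Real.smoothTransition.one_of_one_le (by norm_num)

theorem avgForm_symm (F : FinslerStructure n M) (x : M) (v w : Coord n) :
    F.avgForm x v w = F.avgForm x w v :=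
  fiberForm_symm (F.fiberBump_regular x).1 (F.fiberBump_regular x).2 v w

theorem avgForm_pos (F : FinslerStructure n M) (x : M) {v : Coord n} (hv : v ≠ 0) :
    0 < F.avgForm x v v :=
  fiberForm_pos (F.fiberBump_regular x).1 (F.fiberBump_regular x).2
    (fun _ => Real.smoothTransition.nonneg _) (F.fiberBump_zero x) hv

/-- Linear invariance of the fibre form lets the intrinsic scalar product be computed in any chart.
-/
theorem avgForm_chart (F : FinslerStructure n M)
    (hφ : φ ∈ IsManifold.maximalAtlas (𝓡 n) ∞ M) (ha : a ∈ φ.target) (v w : Coord n) :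
    F.avgForm (φ.symm a) (chartEquiv hφ ha v) (chartEquiv hφ ha w) =
      fiberForm (bump (inNaturalCoords F.toFun φ) a) v w := by
  rw [F.bump_eq_fiberBump hφ ha]
  exact (fiberForm_comp (F.fiberBump_regular _).1 (F.fiberBump_regular _).2 _ v w).symm

/-- A multiple of the averaged scalar product, on the tangent spaces. -/
def tangentForm (F : FinslerStructure n M) (κ : M → ℝ) (x : M) :
    TangentSpace (𝓡 n) x →L[ℝ] TangentSpace (𝓡 n) x →L[ℝ] ℝ :=
  κ x • F.avgForm x

/-- In the trivialization at a point, the section is locally a constant multiple of the fibre form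
of the chart, which depends smoothly on the base point. -/
theorem contMDiff_avgForm (F : FinslerStructure n M) {κ : M → ℝ} (hκ : IsLocallyConstant κ) :
    ContMDiff (𝓡 n) ((𝓡 n).prod 𝓘(ℝ, Coord n →L[ℝ] Coord n →L[ℝ] ℝ)) ∞
      (fun x => TotalSpace.mk' (Coord n →L[ℝ] Coord n →L[ℝ] ℝ) x (F.tangentForm κ x)) := by
  intro x₀
  refine (contMDiffAt_section (s := F.tangentForm κ) x₀).2 ?_
  have hφ := IsManifold.chart_mem_maximalAtlas (I := 𝓡 n) (n := ∞) x₀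
  set φ := chartAt (Coord n) x₀
  have hx₀ : x₀ ∈ φ.source := mem_chart_source _ x₀
  have h1 : ContMDiffAt (𝓡 n) 𝓘(ℝ, Coord n →L[ℝ] Coord n →L[ℝ] ℝ) ∞
      (fun x => κ x₀ • fiberForm (bump (inNaturalCoords F.toFun φ) (φ x))) x₀ := by
    have h2 : ContDiffAt ℝ ∞
        (fun a => κ x₀ • fiberForm (bump (inNaturalCoords F.toFun φ) a)) (φ x₀) :=
      ContDiffAt.const_smul (κ x₀) ((F.isFinsler hφ).isBump.contDiffOn_fiberForm.contDiffAt
        (φ.open_target.mem_nhds (φ.map_source hx₀)))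
    exact h2.contMDiffAt.comp x₀ (contMDiffAt_of_mem_maximalAtlas hφ hx₀)
  refine h1.congr_of_eventuallyEq ?_
  filter_upwards [φ.open_source.mem_nhds hx₀, hκ.eventually_eq x₀] with x hx hκx
  ext v w
  rw [hom_trivializationAt_apply]
  have hb : x ∈ (trivializationAt (Coord n) (TangentSpace (𝓡 n)) x₀).baseSet := by
    simpa using hx
  -- The inverse of the tangent trivialization is the derivative of the inverse chart.
  have hL : ∀ v : Coord n, (trivializationAt (Coord n) (TangentSpace (𝓡 n)) x₀).symm x v =
      chartEquiv hφ (φ.map_source hx) v := by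
    intro v
    have := TangentBundle.symmL_trivializationAt (I := 𝓡 n) (x₀ := x₀) (x := x) hx
    have h3 := congrArg (fun T => T v) this
    have h4 : mfderivWithin (𝓡 n) (𝓡 n) (extChartAt (𝓡 n) x₀).symm (range (𝓡 n))
        (extChartAt (𝓡 n) x₀ x) = mfderiv (𝓡 n) (𝓡 n) φ.symm (φ x) := by
      rw [show range (𝓡 n) = univ by simp, mfderivWithin_univ]
      rfl
    exact (Trivialization.symmL_apply (R := ℝ)
      (trivializationAt (Coord n) (TangentSpace (𝓡 n)) x₀) hb v).symm.trans
        (h3.trans (congrArg (fun T => T v) h4))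
  rw [inCoordinates_apply_eq₂ hb hb (mem_univ _), hL, hL]
  have htriv : ∀ r : ℝ, (trivializationAt ℝ (Bundle.Trivial M ℝ) x₀).linearMapAt ℝ x r = r :=
    fun r => by simp
  refine (htriv _).trans ?_
  change κ x * F.avgForm x (chartEquiv hφ (φ.map_source hx) v)
    (chartEquiv hφ (φ.map_source hx) w) = κ x₀ * fiberForm _ v w
  rw [hκx]
  rw [← F.avgForm_chart hφ (φ.map_source hx), φ.left_inv hx]

/-- A locally constant multiple of the averaged Riemannian metric. -/
def avgMetric (F : FinslerStructure n M) (κ : M → ℝ) (hκ : IsLocallyConstant κ)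
    (hpos : ∀ x, 0 < κ x) : ContMDiffRiemannianMetric (𝓡 n) ∞ (Coord n)
      (fun x : M => TangentSpace (𝓡 n) x) where
  inner := F.tangentForm κ
  symm x v w := congrArg (κ x * ·) (F.avgForm_symm x v w)
  pos x _ hv := mul_pos (hpos x) (F.avgForm_pos x hv)
  isVonNBounded x := isVonNBounded_lt_one (κ x • F.avgForm x)
    fun _ hv => mul_pos (hpos x) (F.avgForm_pos x hv)
  contMDiff := F.contMDiff_avgForm hκ

end FinslerStructure

instance {n : ℕ} : NormedAddCommGroup (Coord n →L[ℝ] Coord n) :=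
  ContinuousLinearMap.toNormedAddCommGroup

instance {n : ℕ} : AddCommGroup (Coord n →L[ℝ] Coord n) := ContinuousLinearMap.addCommGroup

instance {n : ℕ} : NormedSpace ℝ (Coord n →L[ℝ] Coord n) := ContinuousLinearMap.toNormedSpace

namespace FinslerLocal

variable {n : ℕ}

/-! ### Berwald charts -/

/-- The value of the coefficients of the Chern connection if they do not depend on the velocity. -/
def berwaldCoeff (f : Coord n → Coord n → ℝ) (i j k : Fin n) (a : Coord n) : ℝ :=
  -- Any nonzero velocity would serve in the Berwald case; the upper index supplies one without
  -- assuming `n > 0`.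
  chern f i j k a (EuclideanSpace.single i 1)

/-- A Finsler function whose Chern connection does not depend on the velocity. -/
structure IsBerwaldOn (f : Coord n → Coord n → ℝ) (T : Set (Coord n)) : Prop
    extends IsFinsler f T where
  chern_eq : ∀ a ∈ T, ∀ y ≠ 0, ∀ i j k, chern f i j k a y = berwaldCoeff f i j k a

/-- The matrix of the averaged scalar product. -/
def formMatrix (f : Coord n → Coord n → ℝ) (a : Coord n) : Matrix (Fin n) (Fin n) ℝ :=
  Matrix.of fun i j =>
    fiberForm (bump f a) (EuclideanSpace.single i 1) (EuclideanSpace.single j 1)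

theorem form_eq_sum (B : Coord n →L[ℝ] Coord n →L[ℝ] ℝ) (v w : Coord n) :
    B v w = ∑ i, ∑ j, v i * w j * B (EuclideanSpace.single i 1) (EuclideanSpace.single j 1) := by
  conv_lhs => rw [← sum_single v, ← sum_single w]
  simp only [map_sum, map_smul, sum_apply, smul_apply, smul_eq_mul, Finset.mul_sum]
  rw [Finset.sum_comm]
  exact Finset.sum_congr rfl fun i _ => Finset.sum_congr rfl fun j _ => by ring

theorem formMatrix_posDef {B : Coord n →L[ℝ] Coord n →L[ℝ] ℝ} (hs : ∀ v w, B v w = B w v)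
    (hB : ∀ v ≠ 0, 0 < B v v) : (Matrix.of fun i j =>
      B (EuclideanSpace.single i 1) (EuclideanSpace.single j 1) : Matrix (Fin n) (Fin n) ℝ).PosDef := by
  refine Matrix.PosDef.of_dotProduct_mulVec_pos ?_ fun x hx => ?_
  · ext i j; simp [hs (EuclideanSpace.single j 1)]
  · have hx' : (WithLp.toLp 2 x : Coord n) ≠ 0 := fun h => hx (by
      ext i; exact congrArg (fun v : Coord n => v i) h)
    have := hB _ hx'
    rw [form_eq_sum] at this
    simp only [dotProduct, Matrix.mulVec, star_trivial, Finset.mul_sum, Matrix.of_apply]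
    refine this.trans_eq (Finset.sum_congr rfl fun m _ => Finset.sum_congr rfl fun r _ => by ring)

/-- A function of position and velocity whose horizontal derivatives for the connection `Γ` vanish
is constant along parallel fields. -/
theorem hasDerivWithinAt_parallel {Γ : Fin n → Fin n → Fin n → Coord n → ℝ}
    {q : Coord n → Coord n → ℝ} {c W : ℝ → Coord n} {c' : Coord n} {s : Set ℝ} {t : ℝ}
    {Ω : Set (Coord n × Coord n)} (hΩ : IsOpen Ω) (hq : SmoothOn q Ω) (ht : (c t, W t) ∈ Ω)
    (hX : ∀ k, dX k q (c t) (W t) =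
      ∑ l, (∑ m, Γ l k m (c t) * W t m) * dY l q (c t) (W t))
    (hc : HasDerivWithinAt c c' s t)
    (hW : HasDerivWithinAt W
      (WithLp.toLp 2 fun i => -∑ j, ∑ k, Γ i j k (c t) * c' j * W t k) s t) :
    HasDerivWithinAt (fun s => q (c s) (W s)) 0 s t := by
  have h := (hq.differentiableAt hΩ ht).hasFDerivAt.comp_hasDerivWithinAt t (hc.prodMk hW)
  set W' : Coord n := WithLp.toLp 2 fun i => -∑ j, ∑ k, Γ i j k (c t) * c' j * W t k
  have h1 : ((c', W') : Coord n × Coord n) = (c', 0) + (0, W') := by simp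
  have h2 : fderiv ℝ (fun p : Coord n × Coord n => q p.1 p.2) (c t, W t) (c', 0) =
      ∑ k, c' k * dX k q (c t) (W t) := by
    rw [sum_dX, (hq.hasFDerivAt_left hΩ ht).fderiv]; simp
  have h3 : fderiv ℝ (fun p : Coord n × Coord n => q p.1 p.2) (c t, W t) (0, W') =
      ∑ l, W' l * dY l q (c t) (W t) := by
    rw [sum_dY, (hq.hasFDerivAt_right hΩ ht).fderiv]; simp
  -- The parallel equation makes the vertical part of the derivative the negative of the horizontal
  -- part.
  have h4 : fderiv ℝ (fun p : Coord n × Coord n => q p.1 p.2) (c t, W t) (c', W') = 0 := by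
    rw [h1, map_add, h2, h3]
    simp only [hX, W', neg_mul, Finset.sum_neg_distrib, Finset.mul_sum, Finset.sum_mul]
    rw [Finset.sum_comm, ← sub_eq_add_neg, sub_eq_zero]
    exact Finset.sum_congr rfl fun l _ => Finset.sum_congr rfl fun k _ =>
      Finset.sum_congr rfl fun m _ => by ring
  rw [h4] at h
  exact h

/-- Two quantities that are constant along a parallel field, the second one as long as the field
does not vanish. -/
theorem eq_endpoints_of_deriv_zero {H E : ℝ → ℝ}
    (hH : ∀ t ∈ Icc (0 : ℝ) 1, HasDerivWithinAt H 0 (Icc 0 1) t)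
    (hE : ∀ t ∈ Icc (0 : ℝ) 1, H t ≠ 0 → HasDerivWithinAt E 0 (Icc 0 1) t)
    (h0 : ∀ t ∈ Icc (0 : ℝ) 1, H t = 0 → E t = 0) : H 1 = H 0 ∧ E 1 = E 0 := by
  have key : ∀ G : ℝ → ℝ, (∀ t ∈ Icc (0 : ℝ) 1, HasDerivWithinAt G 0 (Icc 0 1) t) →
      ∀ t ∈ Icc (0 : ℝ) 1, G t = G 0 := fun G hG t ht =>
    constant_of_derivWithin_zero (fun s hs => (hG s hs).differentiableWithinAt)
      (fun s hs => (hG s (Ico_subset_Icc_self hs)).derivWithin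
        (uniqueDiffOn_Icc zero_lt_one s (Ico_subset_Icc_self hs))) t ht
  have m0 : (0 : ℝ) ∈ Icc (0 : ℝ) 1 := ⟨le_rfl, zero_le_one⟩
  have m1 : (1 : ℝ) ∈ Icc (0 : ℝ) 1 := ⟨zero_le_one, le_rfl⟩
  refine ⟨key H hH 1 m1, ?_⟩
  by_cases h : H 0 = 0
  · rw [h0 1 m1 ((key H hH 1 m1).trans h), h0 0 m0 h]
  · exact key E (fun t ht => hE t ht (by rw [key H hH t ht]; exact h)) 1 m1

/-- Linear differential equations with small coefficients. -/
theorem exists_linear_ode {A : ℝ → Coord n →L[ℝ] Coord n} (hA : ContinuousOn A (Icc 0 1))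
    (hn : ∀ t ∈ Icc (0 : ℝ) 1, ‖A t‖ ≤ 1 / 2) (y : Coord n) :
    ∃ α : ℝ → Coord n, α 0 = y ∧
      ∀ t ∈ Icc (0 : ℝ) 1, HasDerivWithinAt α (A t (α t)) (Icc 0 1) t := by
  -- On the ball of radius `‖y‖` about `y` the field has norm at most `½ · 2‖y‖ = ‖y‖`, so a
  -- solution stays in the ball for time one and no patching is needed.
  have hPL : IsPicardLindelof (fun t w => A t w) (⟨0, le_rfl, zero_le_one⟩ : Icc (0 : ℝ) 1)
      y ‖y‖₊ 0 ‖y‖₊ (1 / 2) := by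
    refine ⟨fun t ht => ?_, fun w _ => hA.clm_apply continuousOn_const, fun t ht w hw => ?_, ?_⟩
    · exact ((A t).lipschitz.weaken (by exact_mod_cast hn t ht)).lipschitzOnWith
    · have h1 : ‖w‖ ≤ ‖y‖ + ‖y‖ := by
        have := norm_le_norm_add_norm_sub y w
        rw [Metric.mem_closedBall, dist_comm, dist_eq_norm] at hw
        exact this.trans (by gcongr; exact hw)
      calc ‖A t w‖ ≤ ‖A t‖ * ‖w‖ := (A t).le_opNorm w
        _ ≤ 1 / 2 * (‖y‖ + ‖y‖) := by
          gcongr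
          exact hn t ht
        _ = ‖y‖ := by ring
    · simp
  exact hPL.exists_eq_forall_mem_Icc_hasDerivWithinAt₀

/-! ### Parallelism of the averaged metric and local parallel transport. -/

namespace IsBerwaldOn

variable {f : Coord n → Coord n → ℝ} {T : Set (Coord n)} {a : Coord n}

theorem berwaldCoeff_comm (hf : IsBerwaldOn f T) (ha : a ∈ T) (i j k : Fin n) :
    berwaldCoeff f i j k a = berwaldCoeff f i k j a :=
  hf.chern_comm ha (by simp) i j k

theorem dX_energy (hf : IsBerwaldOn f T) (ha : a ∈ T) {y : Coord n} (hy : y ≠ 0) (k : Fin n) :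
    dX k (energy f) a y =
      ∑ l, (∑ m, berwaldCoeff f l k m a * y m) * dY l (energy f) a y := by
  rw [hf.dX_energy_eq_chern ha hy]
  simp only [hf.chern_eq a ha y hy]

theorem fderiv_form (hf : IsBerwaldOn f T) (ha : a ∈ T) (i j k : Fin n) :
    fderiv ℝ (fun b => formMatrix f b i j) a (EuclideanSpace.single k 1) =
      ∑ l, berwaldCoeff f l k i a * formMatrix f a l j +
      ∑ l, berwaldCoeff f l k j a * formMatrix f a i l :=
  hf.isBump.fderiv_fiberForm
    (fun _ hb _ k => hf.dX_bump hb fun hy => hf.dX_energy hb hy k) ha i j k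

theorem smooth_formMatrix (hf : IsBerwaldOn f T) (i j : Fin n) :
    ContDiffOn ℝ ∞ (fun b => formMatrix f b i j) T :=
  (hf.isBump.contDiffOn_fiberForm.clm_apply contDiffOn_const).clm_apply contDiffOn_const

theorem form_symm (hf : IsBerwaldOn f T) (ha : a ∈ T) (v w : Coord n) :
    fiberForm (bump f a) v w = fiberForm (bump f a) w v :=
  fiberForm_symm (hf.isBump.contDiff_fiber ha) (hf.isBump.hasCompactSupport ha) v w

theorem form_pos (hf : IsBerwaldOn f T) (ha : a ∈ T) {v : Coord n} (hv : v ≠ 0) :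
    0 < fiberForm (bump f a) v v :=
  fiberForm_pos (hf.isBump.contDiff_fiber ha) (hf.isBump.hasCompactSupport ha) (hf.isBump.nonneg a)
    (hf.isBump.zero a) hv

theorem isUnit_det_formMatrix (hf : IsBerwaldOn f T) (ha : a ∈ T) :
    IsUnit (formMatrix f a).det :=
  (formMatrix_posDef (hf.form_symm ha) fun _ hv => hf.form_pos ha hv).det_pos.ne'.isUnit

/-- The Chern connection of a Berwald chart is the Levi-Civita connection of any constant multiple
of the averaged metric. -/
theorem christoffel_smul_formMatrix (hf : IsBerwaldOn f T) (ha : a ∈ T) {κ : ℝ} (hκ : κ ≠ 0)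
    (i j k : Fin n) :
    christoffel (κ • formMatrix f a) (fun k => Matrix.of fun i j =>
      κ * fderiv ℝ (fun b => formMatrix f b i j) a (EuclideanSpace.single k 1)) i j k =
      berwaldCoeff f i j k a := by
  refine christoffel_eq_of_parallel (Γ := fun i j k => berwaldCoeff f i j k a) ?_ ?_
    (fun l i j => hf.berwaldCoeff_comm ha l i j) ?_ i j k
  · rw [Matrix.det_smul]
    exact ((hκ.isUnit).pow _).mul (hf.isUnit_det_formMatrix ha)
  · intro i j
    simp only [Matrix.smul_apply, formMatrix, Matrix.of_apply]
    rw [hf.form_symm ha]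
  · intro k i j
    simp only [Matrix.of_apply, Matrix.smul_apply, smul_eq_mul, hf.fderiv_form ha, mul_add,
      Finset.mul_sum]
    congr 1 <;> exact Finset.sum_congr rfl fun l _ => by ring

/-- Read off from the averaged metric, whose Christoffel symbols these coefficients are: they are
rational in its smooth entries and their derivatives. -/
theorem continuousOn_berwaldCoeff (hf : IsBerwaldOn f T) (i j k : Fin n) :
    ContinuousOn (berwaldCoeff f i j k) T := by
  have hM : ContinuousOn (formMatrix f) T :=
    continuousOn_pi.2 fun i => continuousOn_pi.2 fun j => (hf.smooth_formMatrix i j).continuousOn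
  have hinv : ∀ i s, ContinuousOn (fun b => (formMatrix f b)⁻¹ i s) T := fun i s => by
    have h1 : ContinuousOn (fun b => (formMatrix f b).det) T :=
      continuous_id.matrix_det.comp_continuousOn hM
    have h2 : ContinuousOn (fun b => (formMatrix f b).adjugate i s) T :=
      (continuous_id.matrix_adjugate.matrix_elem i s).comp_continuousOn hM
    refine ((h1.inv₀ fun b hb => (hf.isUnit_det_formMatrix hb).ne_zero).mul h2).congr fun b hb => ?_
    simp [Matrix.inv_def]
  have hD : ∀ i j k, ContinuousOn
      (fun b => fderiv ℝ (fun b => formMatrix f b i j) b (EuclideanSpace.single k 1)) T :=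
    fun i j k => ((hf.smooth_formMatrix i j).continuousOn_fderiv_of_isOpen hf.isOpen
      (by simp)).clm_apply continuousOn_const
  have h : ContinuousOn (fun b => christoffel (formMatrix f b) (fun k => Matrix.of fun i j =>
      fderiv ℝ (fun b => formMatrix f b i j) b (EuclideanSpace.single k 1)) i j k) T := by
    simp only [christoffel, Matrix.of_apply]
    exact continuousOn_const.mul (continuousOn_finsetSum _ fun s _ =>
      (hinv i s).mul (((hD s j k).sub (hD j k s)).add (hD s k j)))
  refine h.congr fun b hb => ?_
  have := hf.christoffel_smul_formMatrix hb one_ne_zero i j k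
  simpa only [one_smul, one_mul] using this.symm

theorem smooth_quadratic (hf : IsBerwaldOn f T) :
    SmoothOn (fun b y => fiberForm (bump f b) y y) (T ×ˢ univ) := by
  have h : ContDiffOn ℝ ∞ (fun p : Coord n × Coord n => fiberForm (bump f p.1)) (T ×ˢ univ) :=
    hf.isBump.contDiffOn_fiberForm.comp contDiffOn_fst fun p hp => hp.1
  exact (h.clm_apply contDiffOn_snd).clm_apply contDiffOn_snd

/-- Restates parallelism of the averaged form as horizontal constancy of a function of position and
velocity, so that the argument for the energy applies to it as well. -/
theorem dX_quadratic (hf : IsBerwaldOn f T) (ha : a ∈ T) (y : Coord n) (k : Fin n) :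
    dX k (fun b y => fiberForm (bump f b) y y) a y =
      ∑ l, (∑ m, berwaldCoeff f l k m a * y m) *
        dY l (fun b y => fiberForm (bump f b) y y) a y := by
  have h1 : dX k (fun b y => fiberForm (bump f b) y y) a y =
      ∑ i, ∑ j, y i * y j * (∑ l, berwaldCoeff f l k i a * formMatrix f a l j +
        ∑ l, berwaldCoeff f l k j a * formMatrix f a i l) := by
    have hd : ∀ i j, DifferentiableAt ℝ (fun b => formMatrix f b i j) a := fun i j =>
      ((hf.smooth_formMatrix i j).contDiffAt (hf.isOpen.mem_nhds ha)).differentiableAt (by simp)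
    have h2 : (fun b => fiberForm (bump f b) y y) =
        fun b => ∑ i, ∑ j, y i * y j * formMatrix f b i j := funext fun b => form_eq_sum _ _ _
    simp only [dX, h2]
    rw [fderiv_fun_sum fun i _ => DifferentiableAt.fun_sum fun j _ => (hd i j).const_mul _]
    simp only [sum_apply]
    refine Finset.sum_congr rfl fun i _ => ?_
    rw [fderiv_fun_sum fun j _ => (hd i j).const_mul _]
    simp only [sum_apply]
    refine Finset.sum_congr rfl fun j _ => ?_
    rw [fderiv_const_mul (hd i j), smul_apply, hf.fderiv_form ha, smul_eq_mul]
  have h3 : ∀ l, dY l (fun b y => fiberForm (bump f b) y y) a y =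
      2 * ∑ j, formMatrix f a l j * y j := fun l => by
    have hB := ((fiberForm (bump f a)).hasFDerivAt (x := y)).clm_apply (hasFDerivAt_id y)
    have h4 : (fun z => fiberForm (bump f a) z z) = fun z => fiberForm (bump f a) z (id z) := rfl
    simp only [dY, h4, hB.fderiv]
    have h5 : fiberForm (bump f a) (EuclideanSpace.single l 1) y =
        ∑ j, formMatrix f a l j * y j := by
      conv_lhs => rw [← sum_single y]
      simp only [map_sum, map_smul, smul_eq_mul]
      exact Finset.sum_congr rfl fun j _ => by rw [mul_comm]; rfl
    simp only [add_apply, ContinuousLinearMap.comp_apply, ContinuousLinearMap.flip_apply, id_eq,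
      ContinuousLinearMap.id_apply]
    rw [hf.form_symm ha y, h5]; ring
  have hs : ∀ i j, formMatrix f a i j = formMatrix f a j i := fun i j => hf.form_symm ha _ _
  rw [h1]
  simp only [h3, mul_add, Finset.mul_sum, Finset.sum_add_distrib]
  -- By symmetry of the form its two slots contribute equally, which matches the factor `2` in the
  -- velocity derivative.
  have e1 : ∑ i, ∑ j, ∑ l, y i * y j * (berwaldCoeff f l k i a * formMatrix f a l j) =
      ∑ l, ∑ j, (∑ m, berwaldCoeff f l k m a * y m) * (formMatrix f a l j * y j) := by
    rw [Finset.sum_comm_cycle]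
    refine Finset.sum_congr rfl fun l _ => ?_
    rw [Finset.sum_comm]
    refine Finset.sum_congr rfl fun j _ => ?_
    rw [Finset.sum_mul]
    exact Finset.sum_congr rfl fun i _ => by ring
  have e2 : ∑ i, ∑ j, ∑ l, y i * y j * (berwaldCoeff f l k j a * formMatrix f a i l) =
      ∑ i, ∑ j, ∑ l, y i * y j * (berwaldCoeff f l k i a * formMatrix f a l j) := by
    rw [Finset.sum_comm]
    exact Finset.sum_congr rfl fun i _ => Finset.sum_congr rfl fun j _ =>
      Finset.sum_congr rfl fun l _ => by rw [hs j l]; ring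
  rw [e2, e1, ← Finset.sum_add_distrib]
  refine Finset.sum_congr rfl fun l _ => ?_
  rw [← Finset.sum_add_distrib]
  exact Finset.sum_congr rfl fun j _ => by ring

/-- The energy and the averaged metric are constant along parallel fields. -/
theorem hasDerivWithinAt_quadratic (hf : IsBerwaldOn f T) {c W : ℝ → Coord n} {c' : Coord n}
    {s : Set ℝ} {t : ℝ} (ht : c t ∈ T) (hc : HasDerivWithinAt c c' s t)
    (hW : HasDerivWithinAt W (WithLp.toLp 2 fun i =>
      -∑ j, ∑ k, berwaldCoeff f i j k (c t) * c' j * W t k) s t) :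
    HasDerivWithinAt (fun s => fiberForm (bump f (c s)) (W s) (W s)) 0 s t :=
  hasDerivWithinAt_parallel (Γ := berwaldCoeff f) (hf.isOpen.prod isOpen_univ)
    hf.smooth_quadratic ⟨ht, mem_univ _⟩ (fun k => hf.dX_quadratic ht (W t) k) hc hW

theorem hasDerivWithinAt_energy (hf : IsBerwaldOn f T) {c W : ℝ → Coord n} {c' : Coord n}
    {s : Set ℝ} {t : ℝ} (ht : c t ∈ T) (h0 : W t ≠ 0) (hc : HasDerivWithinAt c c' s t)
    (hW : HasDerivWithinAt W (WithLp.toLp 2 fun i =>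
      -∑ j, ∑ k, berwaldCoeff f i j k (c t) * c' j * W t k) s t) :
    HasDerivWithinAt (fun s => energy f (c s) (W s)) 0 s t :=
  hasDerivWithinAt_parallel (Γ := berwaldCoeff f) hf.isOpen_slit
    hf.energy_smooth ⟨ht, h0⟩ (fun k => hf.dX_energy ht h0 k) hc hW

/-- The linear map that generates the parallel transport in the direction `e`. -/
def generator (f : Coord n → Coord n → ℝ) (a e : Coord n) : Coord n →L[ℝ] Coord n :=
  -∑ i, ∑ j, ∑ k, (berwaldCoeff f i j k a * e j) •
    (EuclideanSpace.proj k : Coord n →L[ℝ] ℝ).smulRight (EuclideanSpace.single i (1 : ℝ))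

theorem generator_apply (a e y : Coord n) : generator f a e y =
    WithLp.toLp 2 fun i => -∑ j, ∑ k, berwaldCoeff f i j k a * e j * y k := by
  ext i
  simp [generator, sum_apply, Finset.sum_apply, Pi.single_apply]

theorem continuousOn_generator (hf : IsBerwaldOn f T) :
    ContinuousOn (fun p : Coord n × Coord n => generator f p.1 p.2) (T ×ˢ univ) := by
  refine ContinuousOn.neg (continuousOn_finsetSum _ fun i _ => continuousOn_finsetSum _ fun j _ =>
    continuousOn_finsetSum _ fun k _ => ContinuousOn.smul (ContinuousOn.mul
      ((hf.continuousOn_berwaldCoeff i j k).comp continuousOn_fst fun p hp => hp.1) ?_)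
      continuousOn_const)
  fun_prop

/-- Parallel transport between nearby points. -/
theorem exists_transport (hf : IsBerwaldOn f T) (ha : a ∈ T) :
    ∃ s ∈ nhds a, s ⊆ T ∧ ∀ b ∈ s, ∀ b' ∈ s, ∀ y, ∃ y', energy f b' y' = energy f b y ∧
      fiberForm (bump f b') y' y' = fiberForm (bump f b) y y := by
  have hg : ContinuousAt (fun p : Coord n × Coord n => generator f p.1 p.2) (a, 0) :=
    hf.continuousOn_generator.continuousAt
      ((hf.isOpen.prod isOpen_univ).mem_nhds ⟨ha, mem_univ _⟩)
  have h0 : generator f a 0 = 0 := by simp [generator]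
  -- The generator is continuous and vanishes for direction zero, so for short segments near `a` it
  -- satisfies the smallness condition of `exists_linear_ode`.
  have h1 : ∀ᶠ p : Coord n × Coord n in nhds (a, 0), ‖generator f p.1 p.2‖ < 1 / 2 ∧ p.1 ∈ T := by
    refine (hg.norm.eventually (gt_mem_nhds ?_)).and
      (continuous_fst.continuousAt.eventually (hf.isOpen.mem_nhds ha))
    simp [h0]
  obtain ⟨δ, hδ, hball⟩ := Metric.eventually_nhds_iff.1 h1
  have h2 : ∀ b ∈ Metric.ball a δ, ∀ e : Coord n, ‖e‖ < δ → ‖generator f b e‖ ≤ 1 / 2 ∧ b ∈ T :=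
    fun b hb e he => (hball (y := (b, e)) (by
      rw [Prod.dist_eq]; exact max_lt hb (by simpa using he))).imp_left le_of_lt
  refine ⟨Metric.ball a (δ / 2), Metric.ball_mem_nhds a (by positivity), fun b hb =>
    (h2 b (Metric.ball_subset_ball (by linarith) hb) 0 (by simpa using hδ)).2, ?_⟩
  intro b hb b' hb' y
  set e := b' - b
  have he : ‖e‖ < δ := by
    rw [← dist_eq_norm]
    calc dist b' b ≤ dist b' a + dist b a := dist_triangle_right _ _ _
      _ < δ / 2 + δ / 2 := add_lt_add hb' hb
      _ = δ := by ring
  -- Transport runs along the straight segment; the half-radius ball is convex and keeps the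
  -- increment `e` shorter than `δ`.
  set c : ℝ → Coord n := fun t => b + t • e
  have hcont : Continuous c := by fun_prop
  have hcb : ∀ t ∈ Icc (0 : ℝ) 1, c t ∈ Metric.ball a δ := fun t ht => by
    refine Metric.ball_subset_ball (by linarith) ((convex_ball a (δ / 2)).add_smul_sub_mem hb hb' ht)
  have hcT : ∀ t ∈ Icc (0 : ℝ) 1, c t ∈ T := fun t ht => (h2 _ (hcb t ht) e he).2
  have hc' : ∀ t ∈ Icc (0 : ℝ) 1, HasDerivWithinAt c e (Icc 0 1) t := fun t _ => by
    have := ((hasDerivAt_id t).smul_const e).const_add b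
    rw [one_smul] at this
    exact this.hasDerivWithinAt
  obtain ⟨α, hα0, hα⟩ := exists_linear_ode (A := fun t => generator f (c t) e)
    (hf.continuousOn_generator.comp (f := fun t => (c t, e)) (by fun_prop)
      fun t ht => ⟨hcT t ht, mem_univ _⟩) (fun t ht => (h2 _ (hcb t ht) e he).1) y
  simp only [generator_apply] at hα
  have := eq_endpoints_of_deriv_zero (H := fun t => fiberForm (bump f (c t)) (α t) (α t))
    (E := fun t => energy f (c t) (α t))
    (fun t ht => hf.hasDerivWithinAt_quadratic (hcT t ht) (hc' t ht) (hα t ht))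
    (fun t ht h => hf.hasDerivWithinAt_energy (hcT t ht)
      (fun h' => h (by simp [h'])) (hc' t ht) (hα t ht))
    (fun t ht h => by
      by_contra h'
      refine (hf.form_pos (hcT t ht) (v := α t) fun h'' => h' ?_).ne' h
      simp [h'', energy, hf.apply_zero])
  have hc0 : c 0 = b := by simp [c]
  have hc1 : c 1 = b' := by simp [c, e]
  refine ⟨α 1, ?_, ?_⟩
  · simpa [hc0, hc1, hα0] using this.2
  · simpa [hc0, hc1, hα0] using this.1

end IsBerwaldOn

end FinslerLocal

namespace FinslerStructure

open FinslerLocal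

variable {n : ℕ} {M : Type*} [TopologicalSpace M] [ChartedSpace (Coord n) M]
  [IsManifold (𝓡 n) ∞ M] {φ : OpenPartialHomeomorph M (Coord n)} {a : Coord n}

/-! ### Berwald structures -/

theorem IsLocallyMinkowski.isBerwald {F : FinslerStructure n M} (hF : F.IsLocallyMinkowski) :
    F.IsBerwald := by
  intro x
  obtain ⟨φ, hφ, hx, h⟩ := hF x
  refine ⟨φ, hφ, hx, fun a ha y y' _ _ i j k => ?_⟩
  rw [IsFinsler.chern_eq_zero_of_minkowski φ.open_target h ha,
    IsFinsler.chern_eq_zero_of_minkowski φ.open_target h ha]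

theorem IsBerwald.exists_chart {F : FinslerStructure n M} (hF : F.IsBerwald) (x : M) :
    ∃ φ ∈ IsManifold.maximalAtlas (𝓡 n) ∞ M, x ∈ φ.source ∧
      IsBerwaldOn (inNaturalCoords F.toFun φ) φ.target := by
  obtain ⟨φ, hφ, hx, h⟩ := hF x
  exact ⟨φ, hφ, hx, F.isFinsler hφ, fun a ha y hy i j k => h a ha y _ hy (by simp) i j k⟩

/-! ### Scaling the averaged metric below the energy. -/

theorem energy_chart (F : FinslerStructure n M) (hφ : φ ∈ IsManifold.maximalAtlas (𝓡 n) ∞ M)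
    (ha : a ∈ φ.target) (y : Coord n) :
    energy (inNaturalCoords F.toFun φ) a y = F.toFun ⟨φ.symm a, chartEquiv hφ ha y⟩ ^ 2 := rfl

/-- The values of the averaged metric on the unit ball of `F`. -/
def ballValues (F : FinslerStructure n M) (x : M) : Set ℝ :=
  {r | ∃ y : Coord n, F.toFun ⟨x, y⟩ ^ 2 ≤ 1 ∧ r = F.avgForm x y y}

theorem ballValues_chart (F : FinslerStructure n M)
    (hφ : φ ∈ IsManifold.maximalAtlas (𝓡 n) ∞ M) (ha : a ∈ φ.target) :
    F.ballValues (φ.symm a) = {r | ∃ y : Coord n, energy (inNaturalCoords F.toFun φ) a y ≤ 1 ∧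
      r = fiberForm (bump (inNaturalCoords F.toFun φ) a) y y} := by
  ext r
  constructor
  · rintro ⟨y, hy, rfl⟩
    refine ⟨(chartEquiv hφ ha).symm y, ?_, ?_⟩
    · rw [F.energy_chart hφ ha, ContinuousLinearEquiv.apply_symm_apply]; exact hy
    · rw [← F.avgForm_chart hφ ha, ContinuousLinearEquiv.apply_symm_apply]
  · rintro ⟨y, hy, rfl⟩
    refine ⟨chartEquiv hφ ha y, ?_, ?_⟩
    · rwa [F.energy_chart hφ ha] at hy
    · rw [F.avgForm_chart hφ ha]

theorem zero_mem_ballValues (F : FinslerStructure n M) (x : M) : 0 ∈ F.ballValues x :=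
  ⟨0, by rw [F.apply_zero]; norm_num, by simp⟩

/-- Quadratic bounds for a Finsler function on a tangent space. -/
theorem exists_bounds (F : FinslerStructure n M) (x : M) :
    ∃ c > 0, ∀ y : Coord n, c * ‖y‖ ^ 2 ≤ F.toFun ⟨x, y⟩ ^ 2 := by
  have hφ := IsManifold.chart_mem_maximalAtlas (I := 𝓡 n) (n := ∞) x
  have ha := mem_chart_target (Coord n) x
  obtain ⟨r, hr, c, hc, -, hb⟩ := (F.isFinsler hφ).exists_energy_bounds ha
  set A := chartEquiv hφ ha
  have hle : ∀ y : Coord n, ‖y‖ ≤ (‖(A : Coord n →L[ℝ] Coord n)‖ + 1) * ‖A.symm y‖ := fun y => by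
    calc ‖y‖ = ‖(A : Coord n →L[ℝ] Coord n) (A.symm y)‖ := by simp
      _ ≤ ‖(A : Coord n →L[ℝ] Coord n)‖ * ‖A.symm y‖ := ContinuousLinearMap.le_opNorm _ _
      _ ≤ _ := by gcongr; linarith
  -- The added `1` keeps `K` positive also in dimension zero.
  set K := ‖(A : Coord n →L[ℝ] Coord n)‖ + 1
  have hK : 0 < K := by positivity
  refine ⟨c / K ^ 2, by positivity, fun y => ?_⟩
  have h1 := (hb _ (Metric.mem_closedBall_self hr.le) (A.symm y)).1
  rw [F.energy_chart hφ ha, (chartAt (Coord n) x).left_inv (mem_chart_source _ x)] at h1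
  simp only [A, ContinuousLinearEquiv.apply_symm_apply] at h1
  refine le_trans ?_ h1
  rw [div_mul_eq_mul_div, div_le_iff₀ (by positivity), mul_assoc, ← mul_pow]
  gcongr
  rw [mul_comm]
  exact hle y

theorem bddAbove_ballValues (F : FinslerStructure n M) (x : M) : BddAbove (F.ballValues x) := by
  obtain ⟨c, hc, h⟩ := F.exists_bounds x
  refine ⟨‖F.avgForm x‖ * c⁻¹, ?_⟩
  rintro r ⟨y, hy, rfl⟩
  have h1 : ‖y‖ ^ 2 ≤ c⁻¹ := by
    rw [← one_div, le_div_iff₀ hc]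
    linarith [h y]
  calc F.avgForm x y y ≤ ‖F.avgForm x‖ * ‖y‖ * ‖y‖ :=
        (le_abs_self _).trans ((F.avgForm x).le_opNorm₂ y y)
    _ = ‖F.avgForm x‖ * ‖y‖ ^ 2 := by ring
    _ ≤ _ := by gcongr

/-- A factor that makes the averaged metric smaller than `F²`. -/
def scale (F : FinslerStructure n M) (x : M) : ℝ := (sSup (F.ballValues x) + 1)⁻¹

theorem sSup_ballValues_nonneg (F : FinslerStructure n M) (x : M) : 0 ≤ sSup (F.ballValues x) :=
  le_csSup (F.bddAbove_ballValues x) (F.zero_mem_ballValues x)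

theorem scale_pos (F : FinslerStructure n M) (x : M) : 0 < F.scale x :=
  inv_pos.2 (by linarith [F.sSup_ballValues_nonneg x])

/-- Transport between nearby points preserves the energy and the averaged form simultaneously, so
the form takes the same set of values on the two unit balls, with the same supremum. -/
theorem IsBerwald.isLocallyConstant_scale {F : FinslerStructure n M} (hF : F.IsBerwald) :
    IsLocallyConstant F.scale := by
  rw [IsLocallyConstant.iff_eventually_eq]
  intro x
  obtain ⟨φ, hφ, hx, hB⟩ := hF.exists_chart x
  obtain ⟨s, hs, hsT, h⟩ := hB.exists_transport (φ.map_source hx)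
  filter_upwards [(φ.continuousAt hx).preimage_mem_nhds hs, φ.open_source.mem_nhds hx] with z hz hzs
  have key : ∀ b ∈ s, ∀ b' ∈ s, F.ballValues (φ.symm b) ⊆ F.ballValues (φ.symm b') := by
    intro b hb b' hb'
    rw [F.ballValues_chart hφ (hsT hb), F.ballValues_chart hφ (hsT hb')]
    rintro r ⟨y, hy, rfl⟩
    obtain ⟨y', h1, h2⟩ := h b hb b' hb' y
    exact ⟨y', h1.le.trans hy, h2.symm⟩
  have hxs := mem_of_mem_nhds hs
  have := (key _ hz _ hxs).antisymm (key _ hxs _ hz)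
  rw [φ.left_inv hx, φ.left_inv hzs] at this
  rw [scale, scale, this]

theorem apply_pos (F : FinslerStructure n M) (x : M) {y : Coord n} (hy : y ≠ 0) :
    0 < F.toFun ⟨x, y⟩ := by
  obtain ⟨c, hc, h⟩ := F.exists_bounds x
  have h1 : 0 < F.toFun ⟨x, y⟩ ^ 2 :=
    lt_of_lt_of_le (mul_pos hc (pow_pos (norm_pos_iff.2 hy) 2)) (h y)
  exact lt_of_le_of_ne (F.nonneg _) fun h0 => by simp [← h0] at h1

/-- After normalizing to `F = 1` the form is bounded by the supremum; the `1` added to the supremum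
makes the inequality strict. -/
theorem scale_mul_avgForm_lt (F : FinslerStructure n M) (x : M) {y : Coord n} (hy : y ≠ 0) :
    F.scale x * F.avgForm x y y < F.toFun ⟨x, y⟩ ^ 2 := by
  have hF := F.apply_pos x hy
  set s := F.toFun ⟨x, y⟩
  have h1 : F.toFun ⟨x, (s⁻¹ • y : Coord n)⟩ = 1 := by
    have := F.homogeneous x y s⁻¹ (inv_pos.2 hF)
    exact this.trans (inv_mul_cancel₀ hF.ne')
  have h2 : F.avgForm x (s⁻¹ • y) (s⁻¹ • y) ≤ sSup (F.ballValues x) :=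
    le_csSup (F.bddAbove_ballValues x) ⟨s⁻¹ • y, by rw [h1]; norm_num, rfl⟩
  simp only [map_smul, smul_apply, smul_eq_mul] at h2
  have h3 : F.avgForm x y y ≤ sSup (F.ballValues x) * s ^ 2 := by
    have h4 : F.avgForm x y y = (s⁻¹ * (s⁻¹ * F.avgForm x y y)) * s ^ 2 := by field_simp
    rw [h4]
    gcongr
  rw [scale, inv_mul_lt_iff₀ (by linarith [F.sSup_ballValues_nonneg x])]
  nlinarith [pow_pos hF 2]

/-! ### Parallel transport on Berwald structures -/

/-- `Γ` is the Chern connection in the charts where this connection lives on the base. -/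
def IsChernConnection (F : FinslerStructure n M)
    (Γ : OpenPartialHomeomorph M (Coord n) → Fin n → Fin n → Fin n → Coord n → ℝ) : Prop :=
  ∀ φ ∈ IsManifold.maximalAtlas (𝓡 n) ∞ M, IsBerwaldOn (inNaturalCoords F.toFun φ) φ.target →
    ∀ a ∈ φ.target, ∀ i j k, Γ φ i j k a = berwaldCoeff (inNaturalCoords F.toFun φ) i j k a

theorem avgForm_apply_chart (F : FinslerStructure n M)
    (hφ : φ ∈ IsManifold.maximalAtlas (𝓡 n) ∞ M) {x : M} (hx : x ∈ φ.source)
    (v : TangentSpace (𝓡 n) x) {w : Coord n} (hw : w = mfderiv (𝓡 n) (𝓡 n) φ x v) :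
    F.avgForm x v v = fiberForm (bump (inNaturalCoords F.toFun φ) (φ x)) w w := by
  rw [← F.avgForm_chart hφ (φ.map_source hx), φ.left_inv hx]
  have h : chartEquiv hφ (φ.map_source hx) w = v := by
    rw [hw]; exact mfderiv_symm_mfderiv hφ hx v
  rw [h]

/-- Derivatives are computed near each parameter in a Berwald chart. The energy is differentiated
only where the field is nonzero; the constant, positive definite form shows that the field vanishes
identically or nowhere. -/
theorem IsBerwald.parallel_invariant {F : FinslerStructure n M} (hF : F.IsBerwald) {κ : M → ℝ}
    (hκ : IsLocallyConstant κ) (hpos : ∀ x, 0 < κ x)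
    {Γ : OpenPartialHomeomorph M (Coord n) → Fin n → Fin n → Fin n → Coord n → ℝ}
    (hΓ : F.IsChernConnection Γ) {c : ℝ → M} (hc : ContMDiffOn 𝓘(ℝ, ℝ) (𝓡 n) 1 c (Icc 0 1))
    {V : ∀ t, TangentSpace (𝓡 n) (c t)} (hV : IsParallelAlong Γ c V) :
    κ (c 1) * F.avgForm (c 1) (V 1) (V 1) = κ (c 0) * F.avgForm (c 0) (V 0) (V 0) ∧
      F.toFun ⟨c 1, V 1⟩ = F.toFun ⟨c 0, V 0⟩ := by
  have main : ∀ t ∈ Icc (0 : ℝ) 1,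
      HasDerivWithinAt (fun s => κ (c s) * F.avgForm (c s) (V s) (V s)) 0 (Icc 0 1) t ∧
      ((V t : Coord n) ≠ 0 →
        HasDerivWithinAt (fun s => F.toFun ⟨c s, V s⟩ ^ 2) 0 (Icc 0 1) t) := by
    intro t ht
    obtain ⟨φ, hφ, hx, hB⟩ := hF.exists_chart (c t)
    have hct : ContinuousWithinAt c (Icc 0 1) t := (hc t ht).continuousWithinAt
    have hsrc : ∀ᶠ s in nhdsWithin t (Icc 0 1), c s ∈ φ.source :=
      hct.preimage_mem_nhdsWithin (φ.open_source.mem_nhds hx)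
    -- Near `t` the factor is constant along the curve and leaves the derivative calculation.
    have hκs : ∀ᶠ s in nhdsWithin t (Icc 0 1), κ (c s) = κ (c t) :=
      hct.eventually (hκ.eventually_eq (c t))
    have hd : HasDerivWithinAt (fun s => φ (c s))
        (derivWithin (fun s => φ (c s)) (Icc 0 1) t) (Icc 0 1) t := by
      have h1 : ContMDiffWithinAt 𝓘(ℝ, ℝ) (𝓡 n) 1 (fun s => φ (c s)) (Icc 0 1) t :=
        ((contMDiffAt_of_mem_maximalAtlas hφ hx).of_le (by simp)).comp_contMDiffWithinAt t (hc t ht)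
      exact ((contMDiffWithinAt_iff_contDiffWithinAt.1 h1).differentiableWithinAt
        (by simp)).hasDerivWithinAt
    have hW := hV φ hφ t ht hx
    simp only [hΓ φ hφ hB _ (φ.map_source hx)] at hW
    set W : ℝ → Coord n := fun s => mfderiv (𝓡 n) (𝓡 n) φ (c s) (V s) with hWdef
    constructor
    · have h1 := (hB.hasDerivWithinAt_quadratic (c := fun s => φ (c s)) (W := W)
        (φ.map_source hx) hd hW).const_mul (κ (c t))
      rw [mul_zero] at h1
      refine h1.congr_of_eventuallyEq ?_ ?_
      · filter_upwards [hsrc, hκs] with s hs hs'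
        rw [hs', F.avgForm_apply_chart hφ hs (V s) (w := W s) rfl]
      · rw [F.avgForm_apply_chart hφ hx (V t) (w := W t) rfl]
    · intro h0
      have hW0 : W t ≠ 0 := fun h => h0 (by
        rw [← mfderiv_symm_mfderiv hφ hx (V t)]
        change mfderiv (𝓡 n) (𝓡 n) φ.symm (φ (c t)) (W t) = (0 : Coord n)
        rw [h]
        exact map_zero (mfderiv (𝓡 n) (𝓡 n) φ.symm (φ (c t))))
      have h1 := hB.hasDerivWithinAt_energy (c := fun s => φ (c s)) (W := W)
        (φ.map_source hx) hW0 hd hW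
      refine h1.congr_of_eventuallyEq ?_ ?_
      · filter_upwards [hsrc] with s hs
        exact congrArg (· ^ 2) (inNaturalCoords_chart F.toFun hφ hs (V s)).symm
      · exact congrArg (· ^ 2) (inNaturalCoords_chart F.toFun hφ hx (V t)).symm
  have := eq_endpoints_of_deriv_zero
    (H := fun t => κ (c t) * F.avgForm (c t) (V t) (V t))
    (E := fun t => F.toFun ⟨c t, V t⟩ ^ 2) (fun t ht => (main t ht).1)
    (fun t ht h => (main t ht).2 fun h0 => h (by
      have : F.avgForm (c t) (V t) (V t) = F.avgForm (c t) (0 : Coord n) (0 : Coord n) :=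
        congrArg (fun v : Coord n => F.avgForm (c t) v v) h0
      simp only [this, map_zero, mul_zero]))
    (fun t _ h => by
      by_contra h'
      refine (mul_pos (hpos (c t)) (F.avgForm_pos (c t) (v := V t) fun h0 => h' ?_)).ne' h
      have : (⟨c t, V t⟩ : TangentBundle (𝓡 n) M) = ⟨c t, (0 : Coord n)⟩ :=
        congrArg (fun v : Coord n => (⟨c t, v⟩ : TangentBundle (𝓡 n) M)) h0
      simp only [this, F.apply_zero]
      norm_num)
  exact ⟨this.1, (pow_left_inj₀ (F.nonneg _) (F.nonneg _) two_ne_zero).1 this.2⟩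

/-- The Levi-Civita connection of a multiple of the averaged metric is the Chern connection. -/
theorem leviCivita_avgMetric (F : FinslerStructure n M) {κ : M → ℝ} (hκ : IsLocallyConstant κ)
    (hpos : ∀ x, 0 < κ x) : F.IsChernConnection (leviCivita (F.avgMetric κ hκ hpos)) := by
  intro φ hφ hB a ha i j k
  have hM : ∀ b ∈ φ.target, ∀ i j, metricMatrix (F.avgMetric κ hκ hpos) φ b i j =
      κ (φ.symm b) * formMatrix (inNaturalCoords F.toFun φ) b i j := fun b hb i j => by
    have := F.avgForm_chart hφ hb (EuclideanSpace.single i 1) (EuclideanSpace.single j 1)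
    exact congrArg (κ (φ.symm b) * ·) this
  -- Local constancy of the factor lets it pass through the derivatives of the metric coefficients.
  have hev : ∀ i j, (fun b => metricMatrix (F.avgMetric κ hκ hpos) φ b i j) =ᶠ[nhds a]
      fun b => κ (φ.symm a) * formMatrix (inNaturalCoords F.toFun φ) b i j := fun i j => by
    filter_upwards [φ.open_target.mem_nhds ha, (φ.symm.continuousAt ha).eventually
      (hκ.eventually_eq (φ.symm a))] with b hb hb'
    rw [hM b hb, hb']
  have h1 : metricMatrix (F.avgMetric κ hκ hpos) φ a =
      κ (φ.symm a) • formMatrix (inNaturalCoords F.toFun φ) a := by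
    ext i j; exact hM a ha i j
  have h2 : ∀ i j k, fderiv ℝ (fun b => metricMatrix (F.avgMetric κ hκ hpos) φ b i j) a
      (EuclideanSpace.single k 1) = κ (φ.symm a) * fderiv ℝ
        (fun b => formMatrix (inNaturalCoords F.toFun φ) b i j) a (EuclideanSpace.single k 1) :=
    fun i j k => by
      rw [(hev i j).fderiv_eq, fderiv_const_mul (((hB.smooth_formMatrix i j).contDiffAt
        (φ.open_target.mem_nhds ha)).differentiableAt (by simp))]
      rfl
  rw [leviCivita, h1]
  simp only [h2]
  exact hB.christoffel_smul_formMatrix ha (hpos _).ne' i j k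

end FinslerStructure

/-! ### The averaged Chern connection of a Berwald chart -/

namespace FinslerLocal

variable {n : ℕ} {f : Coord n → Coord n → ℝ} {T : Set (Coord n)} {a : Coord n}

namespace IsFinsler

theorem continuousOn_fiber {q : Coord n → Coord n → ℝ} (hq : SmoothOn q (T ×ˢ {0}ᶜ)) (ha : a ∈ T) :
    ContinuousOn (q a) {0}ᶜ :=
  ContinuousOn.comp (f := fun z => (a, z)) (ContDiffOn.continuousOn hq)
    (Continuous.prodMk_right a).continuousOn fun _ hz => ⟨ha, hz⟩

theorem measurable_fiber (hf : IsFinsler f T) (ha : a ∈ T) : Measurable (f a) :=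
  measurable_of_continuousOn_compl_singleton 0 (continuousOn_fiber hf.smooth ha)

theorem continuousOn_det (hf : IsFinsler f T) (ha : a ∈ T) :
    ContinuousOn (fun y => (fundamental f a y).det) {0}ᶜ := by
  have h : ContinuousOn (fundamental f a) {0}ᶜ := continuousOn_pi.2 fun i =>
    continuousOn_pi.2 fun j => continuousOn_fiber (hf.fundamental_smooth i j) ha
  exact continuous_id.matrix_det.comp_continuousOn h

/-- The fundamental tensor has degree zero, so a bound on the unit sphere holds off the origin. -/
theorem exists_det_le (hf : IsFinsler f T) (ha : a ∈ T) :
    ∃ C, ∀ y, Real.sqrt (fundamental f a y).det ≤ C := by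
  obtain ⟨C, hC⟩ := (isCompact_sphere (0 : Coord n) 1).exists_bound_of_continuousOn
    ((Real.continuous_sqrt.comp_continuousOn (hf.continuousOn_det ha)).mono
      fun y (hy : y ∈ Metric.sphere (0 : Coord n) 1) (h : y = 0) => by simp [h] at hy)
  -- At the origin the tensor carries no geometric information, and its value is included
  -- separately.
  refine ⟨max C (Real.sqrt (fundamental f a 0).det), fun y => ?_⟩
  rcases eq_or_ne y 0 with rfl | hy
  · exact le_max_right _ _
  have hy' : 0 < ‖y‖ := norm_pos_iff.2 hy
  have h1 : fundamental f a y = fundamental f a (‖y‖⁻¹ • y) := by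
    ext i j
    have := (hf.fundamental_homog i j) a y _ (inv_pos.2 hy')
    rw [pow_zero, one_mul] at this
    exact this.symm
  rw [h1]
  exact (le_abs_self _).trans ((hC (‖y‖⁻¹ • y) (by simp [norm_smul, hy'.ne'])).trans
    (le_max_left _ _))

theorem measurable_density (hf : IsFinsler f T) (ha : a ∈ T) :
    Measurable fun y => ENNReal.ofReal (Real.sqrt (fundamental f a y).det) :=
  (measurable_of_continuousOn_compl_singleton 0 (Real.continuous_sqrt.comp_continuousOn
    (hf.continuousOn_det ha))).ennreal_ofReal

theorem measurableSet_ball (hf : IsFinsler f T) (ha : a ∈ T) : MeasurableSet {y | f a y < 1} :=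
  hf.measurable_fiber ha measurableSet_Iio

theorem fiberVolume_ball_lt_top (hf : IsFinsler f T) (ha : a ∈ T) :
    fiberVolume f a {y | f a y < 1} < ⊤ := by
  obtain ⟨C, hC⟩ := hf.exists_det_le ha
  obtain ⟨r, hr, c, hc, -, hb⟩ := hf.exists_energy_bounds ha
  have hsub : {y | f a y < 1} ⊆ Metric.closedBall (0 : Coord n) (Real.sqrt c⁻¹) := fun y hy => by
    rw [mem_closedBall_zero_iff]
    refine Real.le_sqrt_of_sq_le ?_
    have h1 := (hb a (Metric.mem_closedBall_self hr.le) y).1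
    have h2 : energy f a y ≤ 1 := pow_le_one₀ (hf.nonneg a y) (le_of_lt hy)
    rw [← one_div, le_div_iff₀ hc]
    linarith
  rw [fiberVolume, withDensity_apply _ (hf.measurableSet_ball ha)]
  calc _ ≤ ∫⁻ _ in {y | f a y < 1}, ENNReal.ofReal C :=
        lintegral_mono fun y => ENNReal.ofReal_le_ofReal (hC y)
    _ = ENNReal.ofReal C * volume {y | f a y < 1} := setLIntegral_const _ _
    _ < ⊤ := ENNReal.mul_lt_top ENNReal.ofReal_lt_top
      ((measure_mono hsub).trans_lt (isCompact_closedBall _ _).measure_lt_top)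

/-- The density is positive almost everywhere, so the unit ball of `f`, which contains a Euclidean
ball, is not null. -/
theorem fiberVolume_ball_ne_zero [NeZero n] (hf : IsFinsler f T) (ha : a ∈ T) :
    fiberVolume f a {y | f a y < 1} ≠ 0 := by
  intro h
  have hne : ∀ᵐ y : Coord n, y ≠ 0 := by simp [ae_iff]
  have hac : volume ≪ fiberVolume f a := withDensity_absolutelyContinuous'
    (hf.measurable_density ha).aemeasurable (by
      filter_upwards [hne] with y hy
      simpa using (hf.posDef a ha y hy).det_pos)
  obtain ⟨r, hr, c, hc, -, hb⟩ := hf.exists_energy_bounds ha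
  have hsub : Metric.ball (0 : Coord n) (Real.sqrt c) ⊆ {y | f a y < 1} := fun y hy => by
    have h1 := (hb a (Metric.mem_closedBall_self hr.le) y).2
    have h2 : ‖y‖ < Real.sqrt c := by simpa using hy
    have h3 : ‖y‖ ^ 2 < c := (Real.lt_sqrt (norm_nonneg _)).1 h2
    have h4 : energy f a y < 1 := by
      refine h1.trans_lt ?_
      rw [inv_mul_lt_iff₀ hc]
      linarith
    exact (sq_lt_one_iff₀ (hf.nonneg a y)).1 h4
  exact (Metric.measure_ball_pos volume (0 : Coord n) (Real.sqrt_pos.2 hc)).ne'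
    (measure_mono_null hsub (hac h))

end IsFinsler

/-- The average of a constant for a finite nonzero measure. The work lies in these two properties
and in discarding the zero velocity, where nothing is known about the coefficient. -/
theorem IsBerwaldOn.averagedChern_eq (hf : IsBerwaldOn f T) (ha : a ∈ T) (i j k : Fin n) :
    averagedChern f i j k a = berwaldCoeff f i j k a := by
  -- The mere existence of the index `i` rules out dimension zero, where the factor `n` would kill
  -- the measure.
  have : NeZero n := ⟨fun h => (h ▸ i).elim0⟩
  have hg : Measurable fun y => (f a y)⁻¹ • y :=
    (hf.measurable_fiber ha).inv.smul measurable_id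
  set μ := (fiberVolume f a).restrict {y | f a y < 1}
  have hμ1 : μ univ = fiberVolume f a {y | f a y < 1} := by simp [μ]
  have : IsFiniteMeasure μ := ⟨by rw [hμ1]; exact hf.fiberVolume_ball_lt_top ha⟩
  have hν : indicatrixVolume f a univ = n * fiberVolume f a {y | f a y < 1} := by
    rw [indicatrixVolume, Measure.smul_apply, Measure.map_apply hg MeasurableSet.univ]
    simp
  have : IsFiniteMeasure (indicatrixVolume f a) := ⟨by
    rw [hν]
    exact ENNReal.mul_lt_top (ENNReal.natCast_lt_top n) (hf.fiberVolume_ball_lt_top ha)⟩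
  have : NeZero (indicatrixVolume f a) := ⟨fun h => by
    rw [h, Measure.coe_zero, Pi.zero_apply, eq_comm, mul_eq_zero] at hν
    exact hν.elim (by simpa using NeZero.ne n) (hf.fiberVolume_ball_ne_zero ha)⟩
  have hne : ∀ᵐ y ∂μ, y ≠ 0 := by
    refine ae_restrict_of_ae ?_
    have : ∀ᵐ y : Coord n, y ≠ 0 := by simp [ae_iff]
    exact (withDensity_absolutelyContinuous volume _).ae_le this
  have hae : ∀ᵐ u ∂(indicatrixVolume f a), chern f i j k a u = berwaldCoeff f i j k a := by
    have h0 : ∀ᵐ u ∂(indicatrixVolume f a), u ≠ 0 := by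
      refine Measure.ae_smul_measure ?_ _
      refine (ae_map_iff hg.aemeasurable (p := fun u => u ≠ 0)
        (measurableSet_singleton (0 : Coord n)).compl).2 ?_
      filter_upwards [hne] with y hy
      exact smul_ne_zero (inv_ne_zero (hf.apply_pos ha hy).ne') hy
    filter_upwards [h0] with u hu
    exact hf.chern_eq a ha u hu i j k
  rw [averagedChern, average_congr hae, average_const]

end FinslerLocal

/-! ### Regions between two indicatrices -/

section Region

variable {n : ℕ} {p : Coord n → ℝ} {B : Coord n →L[ℝ] Coord n →L[ℝ] ℝ}

theorem sqrt_form_lt (hp : ∀ y ≠ 0, 0 < p y) (hlt : ∀ y ≠ 0, B y y < p y ^ 2) {y : Coord n}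
    (hy : y ≠ 0) : Real.sqrt (B y y) < p y :=
  (Real.sqrt_lt' (hp y hy)).2 (hlt y hy)

/-- The region between the unit spheres of a homogeneous function `p` and of a smaller Euclidean
norm is swept out by the unit spheres of the interpolating functions. -/
theorem iUnion_interpolate_eq (h0 : p 0 = 0) (hp : ∀ y ≠ 0, 0 < p y)
    (hlt : ∀ y ≠ 0, B y y < p y ^ 2) :
    (⋃ t ∈ Icc (0 : ℝ) 1, {y | (1 - t) * p y + t * Real.sqrt (B y y) = 1}) =
      {y | 1 ≤ p y ∧ B y y ≤ 1} := by
  ext y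
  simp only [mem_iUnion, mem_ofPred_eq, exists_prop]
  constructor
  · rintro ⟨t, ⟨ht0, ht1⟩, h⟩
    have hy : y ≠ 0 := fun hy => by simp [hy, h0] at h
    have h1 := sqrt_form_lt hp hlt hy
    -- A convex combination equal to `1` lies between its two entries, the smaller of which is the
    -- Euclidean norm.
    refine ⟨by nlinarith, Real.sqrt_le_one.1 (by nlinarith)⟩
  · rintro ⟨h1, h2⟩
    have hy : y ≠ 0 := fun hy => by rw [hy, h0] at h1; linarith
    have h3 := sqrt_form_lt hp hlt hy
    have h4 : Real.sqrt (B y y) ≤ 1 := Real.sqrt_le_one.2 h2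
    have h5 : 0 < p y - Real.sqrt (B y y) := sub_pos.2 h3
    -- The solution `t` of the equation, which is affine in `t`.
    refine ⟨(p y - 1) / (p y - Real.sqrt (B y y)), ⟨by apply div_nonneg <;> linarith, ?_⟩, ?_⟩
    · rw [div_le_one h5]; linarith
    · field_simp
      ring

/-- For fixed `y ≠ 0` the interpolation is affine in `t` with nonzero slope, so it takes the value
`1` at most once. -/
theorem pairwiseDisjoint_interpolate (h0 : p 0 = 0) (hp : ∀ y ≠ 0, 0 < p y)
    (hlt : ∀ y ≠ 0, B y y < p y ^ 2) : (Icc (0 : ℝ) 1).PairwiseDisjoint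
      fun t => {y | (1 - t) * p y + t * Real.sqrt (B y y) = 1} := by
  intro s _ t _ hst
  refine Set.disjoint_left.2 fun y hs ht => ?_
  simp only [mem_ofPred_eq] at hs ht
  have hy : y ≠ 0 := fun hy => by simp [hy, h0] at hs
  have h1 := sqrt_form_lt hp hlt hy
  have h2 : (t - s) * (p y - Real.sqrt (B y y)) = 0 := by linarith
  rcases mul_eq_zero.1 h2 with h | h
  · exact hst (sub_eq_zero.1 h).symm
  · linarith

/-- Only the origin needs an argument: boundedness on the sphere gives `|p y| ≤ C ‖y‖`. -/
theorem continuous_of_homogeneous (h0 : p 0 = 0)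
    (hh : ∀ (y : Coord n) (s : ℝ), 0 < s → p (s • y) = s * p y) (hs : ContinuousOn p {0}ᶜ) :
    Continuous p := by
  obtain ⟨C, hC⟩ := (isCompact_sphere (0 : Coord n) 1).exists_bound_of_continuousOn
    (hs.mono fun y (hy : y ∈ Metric.sphere (0 : Coord n) 1) (h : y = 0) => by simp [h] at hy)
  rw [continuous_iff_continuousAt]
  intro y
  rcases eq_or_ne y 0 with rfl | hy
  · have hb : ∀ y, ‖p y‖ ≤ C * ‖y‖ := fun y => by
      rcases eq_or_ne y 0 with rfl | hy
      · simp [h0]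
      have hy' : 0 < ‖y‖ := norm_pos_iff.2 hy
      have h1 := hC (‖y‖⁻¹ • y) (by simp [norm_smul, hy'.ne'])
      rw [hh y _ (inv_pos.2 hy'), norm_mul, norm_inv, norm_norm, inv_mul_le_iff₀ hy'] at h1
      linarith
    rw [ContinuousAt, h0]
    refine squeeze_zero_norm hb ?_
    have : Continuous fun y : Coord n => C * ‖y‖ := by fun_prop
    simpa using this.tendsto 0
  · exact hs.continuousAt (isOpen_compl_singleton.mem_nhds hy)

/-- Since `B < p²`, the faces `p = 1` and `B = 1` are disjoint, so at most one constraint is active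
near each point. Neither face has critical points, because radial derivatives of homogeneous
functions do not vanish there. -/
theorem isCompactCodimZero_region (h0 : p 0 = 0)
    (hh : ∀ (y : Coord n) (s : ℝ), 0 < s → p (s • y) = s * p y)
    (hs : ContDiffOn ℝ ∞ p {0}ᶜ) (hB : ∀ v ≠ 0, 0 < B v v)
    (hlt : ∀ y ≠ 0, B y y < p y ^ 2) : IsCompactCodimZero {y | 1 ≤ p y ∧ B y y ≤ 1} := by
  have hpc : Continuous p := continuous_of_homogeneous h0 hh hs.continuousOn
  have hBs : ContDiff ℝ ∞ fun y => B y y := B.contDiff.clm_apply contDiff_id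
  constructor
  · obtain ⟨c, hc, hcB⟩ := exists_pos_mul_norm_sq_le B hB
    refine (isCompact_closedBall (0 : Coord n) (Real.sqrt c⁻¹)).of_isClosed_subset
      ((isClosed_le continuous_const hpc).inter (isClosed_le hBs.continuous continuous_const))
      fun y hy => ?_
    rw [mem_closedBall_zero_iff]
    refine Real.le_sqrt_of_sq_le ?_
    rw [← one_div, le_div_iff₀ hc]
    linarith [hcB y, hy.2]
  · rintro y ⟨h1, h2⟩
    have hy : y ≠ 0 := fun hy => by rw [hy, h0] at h1; linarith
    rcases h1.eq_or_lt with h1 | h1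
    · right
      have hd : DifferentiableAt ℝ p y :=
        (hs.contDiffAt (isOpen_compl_singleton.mem_nhds hy)).differentiableAt (by simp)
      have hB1 : B y y < 1 := by
        have := hlt y hy
        rwa [← h1, one_pow] at this
      refine ⟨{z | B z z < 1} ∩ {0}ᶜ, fun z => -p z,
        (isOpen_lt hBs.continuous continuous_const).inter isOpen_compl_singleton, ⟨hB1, hy⟩,
        (hs.mono inter_subset_right).neg, fun h => ?_, fun z hz => ?_⟩
      -- Radially, the derivative of `p` at `y` is `p y = 1`, so the differential cannot vanish.
      · have h3 : HasDerivAt (fun s : ℝ => p (s • y)) (fderiv ℝ p y y) 1 := by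
          have hl : HasDerivAt (fun s : ℝ => s • y) y 1 := by
            simpa using (hasDerivAt_id (1 : ℝ)).smul_const y
          exact HasFDerivAt.comp_hasDerivAt (1 : ℝ) (f := fun s : ℝ => s • y)
            (by simpa using hd.hasFDerivAt) hl
        have h4 : HasDerivAt (fun s : ℝ => s * p y) (p y) 1 := by
          simpa using (hasDerivAt_id (1 : ℝ)).mul_const (p y)
        have h5 : (fun s : ℝ => p (s • y)) =ᶠ[nhds 1] fun s => s * p y := by
          filter_upwards [lt_mem_nhds (zero_lt_one (α := ℝ))] with s hs
          exact hh y s hs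
        have h6 := (h3.congr_of_eventuallyEq h5.symm).unique h4
        rw [fderiv_fun_neg, neg_eq_zero] at h
        rw [h, ← h1] at h6
        simp at h6
      · simp only [mem_ofPred_eq, neg_le_neg_iff, ← h1]
        exact ⟨fun h => h.1, fun h => ⟨h, le_of_lt hz.1⟩⟩
    · rcases h2.eq_or_lt with h2 | h2
      · right
        refine ⟨{z | 1 < p z}, fun z => B z z, isOpen_lt continuous_const hpc, h1,
          hBs.contDiffOn, fun h => ?_, fun z hz => ?_⟩
        -- Here the radial derivative is `2 B y y = 2`.
        · have h3 := (B.hasFDerivAt (x := y)).clm_apply (hasFDerivAt_id y)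
          have h4 : (fun z => B z z) = fun z => B z (id z) := rfl
          rw [h4, h3.fderiv] at h
          have h5 := congrArg (fun T => T y) h
          simp at h5
          linarith
        · simp only [mem_ofPred_eq, h2]
          exact ⟨fun h => h.2, fun h => ⟨le_of_lt hz, h⟩⟩
      · left
        filter_upwards [(isOpen_lt continuous_const hpc).mem_nhds h1,
          (isOpen_lt hBs.continuous continuous_const).mem_nhds h2] with z hz1 hz2
        exact ⟨le_of_lt hz1, le_of_lt hz2⟩

end Region

/-! ### The metric of a Berwald space and its invariant regions. -/

namespace FinslerStructure

open FinslerLocal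

section

variable {n : ℕ} {M : Type*} [TopologicalSpace M] [ChartedSpace (Coord n) M]
  [IsManifold (𝓡 n) ∞ M]

theorem contDiffOn_fiber (F : FinslerStructure n M) (x : M) :
    ContDiffOn ℝ ∞ (fun y : Coord n => F.toFun ⟨x, y⟩) {0}ᶜ := by
  have hφ := IsManifold.chart_mem_maximalAtlas (I := 𝓡 n) (n := ∞) x
  have ha := mem_chart_target (Coord n) x
  set A := chartEquiv hφ ha
  have h : (fun y : Coord n => F.toFun ⟨x, y⟩) = fun y => inNaturalCoords F.toFun
      (chartAt (Coord n) x) (chartAt (Coord n) x x) (A.symm y) := by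
    ext y
    have h1 := totalSpace_mk_congr ((chartAt (Coord n) x).left_inv (mem_chart_source _ x)) y
    have h2 : A (A.symm y) = y := A.apply_symm_apply y
    exact congrArg F.toFun (h1.symm.trans (congrArg (fun w : Coord n =>
      (⟨(chartAt (Coord n) x).symm (chartAt (Coord n) x x), w⟩ : TangentBundle (𝓡 n) M)) h2.symm))
  rw [h]
  refine ContDiffOn.comp (f := fun y => (chartAt (Coord n) x x, A.symm y))
    (F.isFinsler hφ).smooth (contDiff_const.prodMk A.symm.contDiff).contDiffOn
    fun y hy => ⟨ha, fun h => hy ?_⟩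
  exact A.symm.map_eq_zero_iff.1 h

theorem averagedChern_isChernConnection (F : FinslerStructure n M) :
    F.IsChernConnection F.averagedChern :=
  fun _ _ hB _ ha i j k => hB.averagedChern_eq ha i j k

/-- On a Berwald space there is a Riemannian metric whose Levi-Civita connection preserves the
indicatrices, and such that the averaged Chern connection preserves the regions between the
indicatrices of `F` and of the metric. -/
theorem IsBerwald.exists_metric {F : FinslerStructure n M} (hF : F.IsBerwald) :
    ∃ h : ContMDiffRiemannianMetric (𝓡 n) ∞ (Coord n) (fun x : M => TangentSpace (𝓡 n) x),
      LeavesInvariant (leviCivita h) F.indicatrix ∧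
      (∀ x : M, (Icc (0 : ℝ) 1).PairwiseDisjoint (F.interpIndicatrix h x)) ∧
      (∀ x : M, IsCompactCodimZero (n := n) (F.sweptRegion h x)) ∧
      LeavesInvariant F.averagedChern (F.sweptRegion h) := by
  have hκ := hF.isLocallyConstant_scale
  have hpos := F.scale_pos
  set h := F.avgMetric F.scale hκ hpos
  set B : M → Coord n →L[ℝ] Coord n →L[ℝ] ℝ := fun x => F.scale x • F.avgForm x
  have hlt : ∀ x, ∀ y : Coord n, y ≠ 0 → B x y y < F.toFun ⟨x, y⟩ ^ 2 :=
    fun x y hy => F.scale_mul_avgForm_lt x hy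
  have hBpos : ∀ x, ∀ y : Coord n, y ≠ 0 → 0 < B x y y :=
    fun x y hy => mul_pos (hpos x) (F.avgForm_pos x hy)
  -- This description involves only the values of `F` and of the scaled form, and parallel transport
  -- preserves both.
  have hregion : ∀ x, F.sweptRegion h x = {y : Coord n | 1 ≤ F.toFun ⟨x, y⟩ ∧ B x y y ≤ 1} :=
    fun x => iUnion_interpolate_eq (p := fun y : Coord n => F.toFun ⟨x, y⟩) (B := B x)
      (F.apply_zero x) (fun y hy => F.apply_pos x hy) (hlt x)
  refine ⟨h, ?_, fun x => ?_, fun x => ?_, ?_⟩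
  · intro c hc V hV
    have := (hF.parallel_invariant hκ hpos (F.leviCivita_avgMetric hκ hpos) hc hV).2
    simp only [indicatrix, mem_ofPred_eq, this]
  · exact pairwiseDisjoint_interpolate (p := fun y : Coord n => F.toFun ⟨x, y⟩) (B := B x)
      (F.apply_zero x) (fun y hy => F.apply_pos x hy) (hlt x)
  · rw [hregion]
    exact isCompactCodimZero_region (p := fun y : Coord n => F.toFun ⟨x, y⟩) (B := B x)
      (F.apply_zero x) (fun y s hs => F.homogeneous x y s hs)
      (F.contDiffOn_fiber x) (hBpos x) (hlt x)
  · intro c hc V hV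
    obtain ⟨h1, h2⟩ := hF.parallel_invariant hκ hpos F.averagedChern_isChernConnection hc hV
    rw [hregion, hregion]
    change (1 ≤ F.toFun ⟨c 0, V 0⟩ ∧ F.scale (c 0) * F.avgForm (c 0) (V 0) (V 0) ≤ 1) ↔
      (1 ≤ F.toFun ⟨c 1, V 1⟩ ∧ F.scale (c 1) * F.avgForm (c 1) (V 1) (V 1) ≤ 1)
    rw [h1, h2]

end

end FinslerStructure

end

theorem theorem4p2 {n : ℕ} {M : Type*} [TopologicalSpace M] [T2Space M]
    [SecondCountableTopology M] [ChartedSpace (EuclideanSpace ℝ (Fin n)) M]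
    [IsManifold (𝓡 n) ∞ M] (F : FinslerStructure n M) (hF : F.IsLandsberg)
    (hinv : ∀ h : ContMDiffRiemannianMetric (𝓡 n) ∞ (EuclideanSpace ℝ (Fin n))
        (fun x : M => TangentSpace (𝓡 n) x),
      LeavesInvariant (leviCivita h) F.indicatrix →
      (∀ x : M, (Icc (0 : ℝ) 1).PairwiseDisjoint (F.interpIndicatrix h x)) →
      (∀ x : M, IsCompactCodimZero (n := n) (F.sweptRegion h x)) →
      ¬ LeavesInvariant F.averagedChern (F.sweptRegion h)) :
    F.IsPureLandsberg := by
  refine ⟨hF, fun hB => ?_⟩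
  -- Both ways of failing to be pure lead to the Berwald case.
  have hB' : F.IsBerwald := hB.elim id FinslerStructure.IsLocallyMinkowski.isBerwald
  obtain ⟨h, h1, h2, h3, h4⟩ := hB'.exists_metric
  exact hinv h h1 h2 h3 h4
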